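/- Let $0<k\le l$, $M_c>0$, $M>0$ and $L_0>0$. For $x,v\in\mathbb R^3$ put $L=|x|^2|v|^2-(x\cdot v)^2$. For a nonnegative $f\in L^1(\mathbb R^6)$ let $\rho_f(x)=\int f(x,v)\,dv$, $m_f(r)=\int_{|x|\le r}\rho_f(x)\,dx$, $\nabla U_f(x)=\frac{m_f(|x|)}{|x|^2}\frac{x}{|x|}$, and $$E_{\rm kin}(f)=\tfrac12\iint |v|^2 f\,dv\,dx,\qquad E_{\rm pot}(f)=-\frac1{8\pi}\int\Big(|\nabla U_f(x)|^2+\frac{8\pi M_c}{|x|}\rho_f(x)\Big)dx,$$ $$\mathcal C(f)=\iint f^{1+1/k}(L-L_0)_+^{-l/k}\,dv\,dx,\qquad \mathcal H_C=E_{\rm kin}+E_{\rm pot}+\mathcal C .$$ Here $(L-L_0)_+^{-l/k}=\infty$ where $L\le L_0$, and $0\cdot\infty=0$. Call $f$ spherically symmetric if for every $A\in O(3)$ one has $f(Ax,Av)=f(x,v)$ for almost all $(x,v)$. Let $\mathcal F_M$ be the set of all spherically symmetric $f\in L^1(\mathbb R^6)$ with $f\ge0$ a.e., $\iint f=M$,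 $E_{\rm kin}(f)+\mathcal C(f)<\infty$, and $f(x,v)=0$ for a.e. $(x,v)$ with $L<L_0$. Let $h_M=\inf_{\mathcal F_M}\mathcal H_C$. Let $L^{k,l}$ be the space of (classes of) measurable spherically symmetric functions $f:\mathbb R^6\to\mathbb R$ with finite norm $\|f\|_{k,l}=\big(\iint|f|^{1+1/k}(L-L_0)_+^{-l/k}\,dx\,dv\big)^{k/(k+1)}$. Let $(f_j)\subset\mathcal F_M$ be a minimizing sequence, that is, $\mathcal H_C(f_j)\to h_M$. Then there are $f_0\in\mathcal F_M$ (in particular $\iint f_0=M$) and a subsequence $(f_{j_i})_i$ such that $\mathcal H_C(f_0)=h_M$, $f_{j_i}\rightharpoonup f_0$ weakly in $L^{k,l}$, and $\nabla U_{f_{j_i}}\to\nabla U_{f_0}$ strongly in $L^2(\mathbb R^3)$ (all these gradients being in $L^2(\mathbb R^3)$). -/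

import Mathlib

open MeasureTheory Filter Topology
open scoped ENNReal

namespace VlasovShell

noncomputable section

/-- Position space (and velocity space) `ℝ³` with its Euclidean structure. -/
abbrev R3 : Type := EuclideanSpace ℝ (Fin 3)

/-- Phase space `ℝ³ × ℝ³`, points are `z = (x, v)`; its `volume` is Lebesgue measure on `ℝ⁶`. -/
abbrev Phase : Type := R3 × R3

/-- Modulus of angular momentum squared, `L = |x × v|² = |x|² |v|² - (x · v)²`. -/
def angMomSq (z : Phase) : ℝ := ‖z.1‖ ^ 2 * ‖z.2‖ ^ 2 - (inner ℝ z.1 z.2) ^ 2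

/-- Spherical symmetry of (the almost-everywhere class of) `f`: for every `A ∈ O(3)`,
`f (A x, A v) = f (x, v)` for almost every `(x, v)`. -/
def SphSymm (f : Phase → ℝ) : Prop :=
  ∀ A : R3 ≃ₗᵢ[ℝ] R3, ∀ᵐ z : Phase, f (A z.1, A z.2) = f z

/-- The weight `(L - L₀)₊ ^ (-l / k)`, with value `∞` where `L ≤ L₀`. -/
def weight (k l L₀ : ℝ) (z : Phase) : ℝ≥0∞ := ENNReal.ofReal (angMomSq z - L₀) ^ (-(l / k))

/-- The spatial density `ρ_f (x) = ∫ f (x, v) dv`. -/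
def rho (f : Phase → ℝ) (x : R3) : ℝ := ∫ v : R3, f (x, v)

/-- The mass inside the closed ball of radius `r`. -/
def massIn (ρ : R3 → ℝ) (r : ℝ) : ℝ := ∫ x in Metric.closedBall (0 : R3) r, ρ x

/-- The gradient of the potential induced by `f`,
`∇U_f (x) = (m (r) / r²) (x / r)` with `r = |x|` and `m (r) = ∫_{|y| ≤ r} ρ_f (y) dy`. -/
def gradU (f : Phase → ℝ) (x : R3) : R3 :=
  (massIn (rho f) ‖x‖ / ‖x‖ ^ 2) • (‖x‖⁻¹ • x)

/-- Kinetic energy, as an integral with values in `[0, ∞]` (for `f ≥ 0`). -/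
def eKin (f : Phase → ℝ) : ℝ≥0∞ := ∫⁻ z : Phase, ENNReal.ofReal (1 / 2 * ‖z.2‖ ^ 2 * f z)

/-- The negative of the potential energy, as an integral with values in `[0, ∞]` (for `f ≥ 0`):
`(1 / 8π) ∫ (|∇U_f (x)|² + (8π M_c / |x|) ρ_f (x)) dx`. -/
def negEPot (Mc : ℝ) (f : Phase → ℝ) : ℝ≥0∞ :=
  ∫⁻ x : R3, ENNReal.ofReal
    (1 / (8 * Real.pi) * (‖gradU f x‖ ^ 2 + 8 * Real.pi * Mc / ‖x‖ * rho f x))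

/-- The Casimir functional `∬ f ^ (1 + 1 / k) (L - L₀)₊ ^ (-l / k)`, with values in `[0, ∞]`
(for `f ≥ 0`). By `0 * ∞ = 0`, points where `f = 0` do not contribute. -/
def casimir (k l L₀ : ℝ) (f : Phase → ℝ) : ℝ≥0∞ :=
  ∫⁻ z : Phase, ENNReal.ofReal (f z) ^ (1 + 1 / k) * weight k l L₀ z

/-- The energy-Casimir functional `E_kin + E_pot + C`. -/
def energyCasimir (k l L₀ Mc : ℝ) (f : Phase → ℝ) : EReal :=
  ((eKin f + casimir k l L₀ f : ℝ≥0∞) : EReal) - ((negEPot Mc f : ℝ≥0∞) : EReal)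

/-- The admissible set `F_M`. -/
structure Admissible (k l L₀ M : ℝ) (f : Phase → ℝ) : Prop where
  integrable : Integrable f
  nonneg : ∀ᵐ z : Phase, 0 ≤ f z
  sphSymm : SphSymm f
  mass : ∫ z : Phase, f z = M
  finite : eKin f + casimir k l L₀ f < ∞
  vanish : ∀ᵐ z : Phase, angMomSq z < L₀ → f z = 0

/-- `h_M`, the infimum of the energy-Casimir functional over `F_M`. -/
def hInf (k l L₀ Mc M : ℝ) : EReal :=
  sInf (energyCasimir k l L₀ Mc '' {f | Admissible k l L₀ M f})

/-- The measure `(L - L₀)₊ ^ (-l / k) dx dv`. It is infinite on every set of positive Lebesgue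
measure inside `{L ≤ L₀}`, and has the same null sets as Lebesgue measure. -/
def weightedMeasure (k l L₀ : ℝ) : Measure Phase := volume.withDensity (weight k l L₀)

/-- The exponent `1 + 1 / k` as an extended nonnegative number. -/
def expo (k : ℝ) : ℝ≥0∞ := 1 + ENNReal.ofReal (1 / k)

instance (k : ℝ) : Fact (1 ≤ expo k) := ⟨le_self_add⟩

/-- The Banach space `L^{k,l}` of classes of spherically symmetric functions with
`∬ |f| ^ (1 + 1 / k) (L - L₀)₊ ^ (-l / k) < ∞`, with the norm
`(∬ |f| ^ (1 + 1 / k) (L - L₀)₊ ^ (-l / k)) ^ (k / (k + 1))` of the ambient `Lp` space. -/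
def Lkl (k l L₀ : ℝ) : Submodule ℝ (Lp ℝ (expo k) (weightedMeasure k l L₀)) where
  carrier := {u | ∃ g : Phase → ℝ, u =ᵐ[weightedMeasure k l L₀] g ∧ SphSymm g}
  add_mem' := by
    rintro u w ⟨g, hu, hg⟩ ⟨h, hw, hh⟩
    refine ⟨g + h, (Lp.coeFn_add u w).trans (hu.add hw), fun A => ?_⟩
    filter_upwards [hg A, hh A] with z h1 h2
    simp only [Pi.add_apply, h1, h2]
  zero_mem' := ⟨0, Lp.coeFn_zero _ _ _, fun A => by simp⟩
  smul_mem' := by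
    rintro c u ⟨g, hu, hg⟩
    refine ⟨c • g, (Lp.coeFn_smul c u).trans (hu.const_smul c), fun A => ?_⟩
    filter_upwards [hg A] with z h1
    simp only [Pi.smul_apply, h1]

/-- `f` is (a representative of) an element of `L^{k,l}`. -/
def MemLkl (k l L₀ : ℝ) (f : Phase → ℝ) : Prop :=
  MemLp f (expo k) (weightedMeasure k l L₀) ∧ SphSymm f

/-- The element of `L^{k,l}` represented by `f`. -/
def toLkl {k l L₀ : ℝ} {f : Phase → ℝ} (hf : MemLkl k l L₀ f) : Lkl k l L₀ :=
  ⟨hf.1.toLp f, f, hf.1.coeFn_toLp, hf.2⟩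

/-- Weak convergence `f j ⇀ g` in `L^{k,l}`: all functions belong to `L^{k,l}`, and
`φ (f j) → φ g` for every continuous linear functional `φ` on `L^{k,l}`. -/
def WeakTendsto (k l L₀ : ℝ) (f : ℕ → Phase → ℝ) (g : Phase → ℝ) : Prop :=
  ∃ (hf : ∀ j, MemLkl k l L₀ (f j)) (hg : MemLkl k l L₀ g),
    ∀ φ : Lkl k l L₀ →L[ℝ] ℝ, Tendsto (fun j => φ (toLkl (hf j))) atTop (𝓝 (φ (toLkl hg)))

/-- A minimizing sequence of the energy-Casimir functional over `F_M`. -/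
def IsMinimizingSeq (k l L₀ Mc M : ℝ) (f : ℕ → Phase → ℝ) : Prop :=
  (∀ j, Admissible k l L₀ M (f j)) ∧
    Tendsto (fun j => energyCasimir k l L₀ Mc (f j)) atTop (𝓝 (hInf k l L₀ Mc M))

end

end VlasovShell

/-! On admissible functions the energy consists of a kinetic and a `1/|x|` term, both linear in `f`,
a uniformly convex Casimir term, and minus a quadratic field term. By the parallelogram law, the
energy of a midpoint is the mean energy, minus the midpoint convexity defect of the Casimir term,
plus `1/(32π) ‖∇U_f - ∇U_g‖²` (`Admissible.energyReal_midpoint`). Midpoints are admissible, so their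
energy is at least the infimum. Along a minimizing sequence the Casimir defect is therefore
asymptotically bounded by the field differences, and compactness of the fields alone yields strong
convergence in the weighted `L^p` (`exists_subseq_tendsto_Lp`).

The fields are compact because `|x|²|v|² ≥ L₀` on the support: the enclosed mass is at most `min(M,
kin r²/L₀)`, which gives an integrable majorant of the squared field. Its integral grows only like
the square root of the kinetic energy, whence coercivity (`exists_energyReal_ge`). Helly's theorem
and dominated convergence give a subsequence with Cauchy fields (`exists_subseq_gradU_cauchy`).

In the limit the enclosed masses, the fields, the `1/|x|` moment and the Casimir term converge, and
the kinetic energy is lower semicontinuous, so the limit has energy at most the infimum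
(`energyReal_limit_le`). Only mass can be lost, at infinity. If a mass `m > 0` were missing, a cloud
of mass `m` at distance `R` with speeds of order `R^(-1/2)` could be added. The attraction of the
centre gains at least `Mc m/(2R)`; the other costs are a small multiple of `1/R`, plus the cloud's
own Casimir contribution, which is `o(1/R)` because `k ≤ l`. The sum would have mass `M` and energy
below the infimum (`exists_energyReal_lt`). -/

namespace VlasovShell

/-! ### Uniform convexity of the power function and convergence in `L^p` -/

/-- The midpoint convexity defect of `t ↦ t ^ p` controls `|a - b| ^ p`, up to a small multiple
of `a ^ p + b ^ p`. -/
theorem exists_abs_sub_rpow_le {p : ℝ} (hp : 1 < p) {ε : ℝ} (hε : 0 < ε) :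
    ∃ K : ℝ, 0 ≤ K ∧ ∀ a b : ℝ, 0 ≤ a → 0 ≤ b →
      |a - b| ^ p ≤ ε * (a ^ p + b ^ p) + K * ((a ^ p + b ^ p) / 2 - ((a + b) / 2) ^ p) := by
  have hp0 : 0 < p := by linarith
  set D : ℝ → ℝ := fun t => (t ^ p + (1 - t) ^ p) / 2 - (1 / 2) ^ p with hD
  have hmid : ∀ a b : ℝ, 0 ≤ a → 0 ≤ b → a ≠ b → ((a + b) / 2) ^ p < (a ^ p + b ^ p) / 2 := by
    intro a b ha hb hab
    have h := (strictConvexOn_rpow hp).2 (Set.mem_Ici.2 ha) (Set.mem_Ici.2 hb) hab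
      (show (0 : ℝ) < 1 / 2 by norm_num) (show (0 : ℝ) < 1 / 2 by norm_num) (by norm_num)
    simp only [smul_eq_mul] at h
    have e : 1 / 2 * a + 1 / 2 * b = (a + b) / 2 := by ring
    rw [e] at h
    linarith
  have hDcont : Continuous D := by
    have h1 : Continuous fun t : ℝ => t ^ p := Real.continuous_rpow_const hp0.le
    have h2 : Continuous fun t : ℝ => (1 - t) ^ p := h1.comp (continuous_const.sub continuous_id)
    exact ((h1.add h2).div_const 2).sub continuous_const
  -- By homogeneity it suffices to treat `a + b = 1`. `S` collects the `t` for which the `ε` term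
  -- alone does not suffice; it is compact and avoids `1/2`, so the defect `D` has a positive
  -- minimum on it.
  set S : Set ℝ := Set.Icc 0 1 ∩ {t | ε * (t ^ p + (1 - t) ^ p) ≤ |t - (1 - t)| ^ p} with hS
  have hScomp : IsCompact S := by
    refine isCompact_Icc.inter_right (isClosed_le ?_ ?_)
    · have h1 : Continuous fun t : ℝ => t ^ p := Real.continuous_rpow_const hp0.le
      exact continuous_const.mul (h1.add (h1.comp (continuous_const.sub continuous_id)))
    · exact (Real.continuous_rpow_const hp0.le).comp (by fun_prop)
  have hDpos : ∀ t ∈ S, 0 < D t := by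
    rintro t ⟨⟨h0, h1⟩, ht⟩
    have hne : t ≠ 1 - t := by
      intro h
      have hpos : 0 < t := by linarith
      simp only [Set.mem_ofPred_eq] at ht
      rw [← h, sub_self, abs_zero, Real.zero_rpow hp0.ne'] at ht
      have := Real.rpow_pos_of_pos hpos p
      nlinarith
    have := hmid t (1 - t) h0 (by linarith) hne
    have e : (t + (1 - t)) / 2 = 1 / 2 := by ring
    rw [e] at this
    simp only [hD]
    linarith
  have hDnn : ∀ t ∈ Set.Icc (0 : ℝ) 1, 0 ≤ D t := by
    rintro t ⟨h0, h1⟩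
    by_cases hne : t = 1 - t
    · have : t = 1 / 2 := by linarith
      subst this
      simp only [hD]
      norm_num
    · have := hmid t (1 - t) h0 (by linarith) hne
      have e : (t + (1 - t)) / 2 = 1 / 2 := by ring
      rw [e] at this
      simp only [hD]
      linarith
  obtain ⟨K, hK0, hK⟩ : ∃ K : ℝ, 0 ≤ K ∧ ∀ t ∈ S, 1 ≤ K * D t := by
    rcases S.eq_empty_or_nonempty with h | h
    · exact ⟨0, le_rfl, by simp [h]⟩
    · obtain ⟨t₀, ht₀, hmin⟩ := hScomp.exists_isMinOn h hDcont.continuousOn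
      have h0 := hDpos t₀ ht₀
      refine ⟨(D t₀)⁻¹, by positivity, fun t ht => ?_⟩
      rw [← inv_mul_cancel₀ h0.ne']
      exact mul_le_mul_of_nonneg_left (hmin ht) (by positivity)
  have key : ∀ t ∈ Set.Icc (0 : ℝ) 1,
      |t - (1 - t)| ^ p ≤ ε * (t ^ p + (1 - t) ^ p) + K * D t := by
    intro t ht
    have hs : 0 ≤ ε * (t ^ p + (1 - t) ^ p) := by
      have := Real.rpow_nonneg ht.1 p
      have := Real.rpow_nonneg (sub_nonneg.2 ht.2) p
      positivity
    by_cases hmem : t ∈ S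
    · have h1 : |t - (1 - t)| ^ p ≤ 1 := by
        refine Real.rpow_le_one (abs_nonneg _) ?_ hp0.le
        rw [abs_le]
        constructor <;> linarith [ht.1, ht.2]
      linarith [hK t hmem]
    · have h1 : |t - (1 - t)| ^ p < ε * (t ^ p + (1 - t) ^ p) := by
        by_contra hcon
        exact hmem ⟨ht, not_lt.1 hcon⟩
      have := mul_nonneg hK0 (hDnn t ht)
      linarith
  refine ⟨K, hK0, fun a b ha hb => ?_⟩
  rcases (add_nonneg ha hb).eq_or_lt with h0 | h0
  · have ha0 : a = 0 := by linarith
    have hb0 : b = 0 := by linarith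
    subst ha0 hb0
    simp [Real.zero_rpow hp0.ne']
  · set s := a + b with hs
    have ea : a = s * (a / s) := by field_simp
    have eb : b = s * (1 - a / s) := by field_simp; linarith
    have ht : a / s ∈ Set.Icc (0 : ℝ) 1 := by
      constructor
      · positivity
      · rw [div_le_one h0]; linarith
    have hk := key _ ht
    have hsp := Real.rpow_pos_of_pos h0 p
    have e1 : a ^ p = s ^ p * (a / s) ^ p := by
      conv_lhs => rw [ea]
      exact Real.mul_rpow h0.le ht.1
    have e2 : b ^ p = s ^ p * (1 - a / s) ^ p := by
      conv_lhs => rw [eb]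
      exact Real.mul_rpow h0.le (by linarith [ht.2])
    have e3 : |a - b| ^ p = s ^ p * |a / s - (1 - a / s)| ^ p := by
      have : a - b = s * (a / s - (1 - a / s)) := by rw [mul_sub, ← ea, ← eb]
      rw [this, abs_mul, abs_of_pos h0, Real.mul_rpow h0.le (abs_nonneg _)]
    have e4 : (s / 2) ^ p = s ^ p * (1 / 2) ^ p := by
      rw [← Real.mul_rpow h0.le (by norm_num)]; congr 1; ring
    rw [e1, e2, e3, e4]
    have := mul_le_mul_of_nonneg_left hk hsp.le
    simp only [hD] at this
    linarith

/-- Convexity applied to `a + b = (1 - θ) (a / (1 - θ)) + θ (b / θ)`. For small `θ` the factor of `a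
^ p` is close to 1, which makes adding a small perturbation cheap. -/
theorem convex_comb_rpow_le {p : ℝ} (hp : 1 ≤ p) {a b θ : ℝ} (ha : 0 ≤ a) (hb : 0 ≤ b)
    (hθ : 0 < θ) (hθ1 : θ < 1) :
    (a + b) ^ p ≤ (1 - θ) ^ (1 - p) * a ^ p + θ ^ (1 - p) * b ^ p := by
  have h1 : 0 < 1 - θ := by linarith
  have h := (convexOn_rpow hp).2 (Set.mem_Ici.2 (div_nonneg ha h1.le)) (Set.mem_Ici.2 (div_nonneg hb hθ.le))
    h1.le hθ.le (by ring)
  simp only [smul_eq_mul] at h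
  have e1 : (1 - θ) * (a / (1 - θ)) = a := by field_simp
  have e2 : θ * (b / θ) = b := by field_simp
  rw [e1, e2, Real.div_rpow ha h1.le, Real.div_rpow hb hθ.le] at h
  rw [Real.rpow_sub h1, Real.rpow_sub hθ, Real.rpow_one, Real.rpow_one]
  calc _ ≤ _ := h
    _ = _ := by ring

/-- A sequence of nonnegative functions, bounded in `L^p`, whose midpoint convexity defects
vanish asymptotically, converges in `L^p`. -/
theorem exists_tendsto_eLpNorm_of_midpoint {α : Type*} [MeasurableSpace α] {μ : Measure α}
    {q : ℝ≥0∞} (hq1 : 1 < q.toReal) (hqt : q ≠ ∞) {f : ℕ → α → ℝ}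
    (hf : ∀ n, MemLp (f n) q μ) (hf0 : ∀ n, ∀ᵐ x ∂μ, 0 ≤ f n x) {B : ℝ}
    (hB : ∀ n, ∫ x, f n x ^ q.toReal ∂μ ≤ B)
    (hdef : ∀ ε > 0, ∃ N, ∀ i ≥ N, ∀ j ≥ N,
      (∫ x, f i x ^ q.toReal ∂μ + ∫ x, f j x ^ q.toReal ∂μ) / 2
        - ∫ x, ((f i x + f j x) / 2) ^ q.toReal ∂μ ≤ ε) :
    ∃ g, MemLp g q μ ∧ Tendsto (fun n => eLpNorm (f n - g) q μ) atTop (𝓝 0) := by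
  set p := q.toReal with hp
  have hp0 : 0 < p := by linarith
  have hq0 : q ≠ 0 := by
    rintro rfl
    simp [hp] at hp0
  have hq1' : 1 ≤ q := by
    rw [← ENNReal.ofReal_toReal hqt]
    simpa using hq1.le
  have : Fact (1 ≤ q) := ⟨hq1'⟩
  have hint : ∀ n, Integrable (fun x => f n x ^ p) μ := by
    intro n
    refine ((hf n).integrable_norm_rpow hq0 hqt).congr ?_
    filter_upwards [hf0 n] with x hx
    rw [Real.norm_of_nonneg hx]
  have hmid : ∀ i j, Integrable (fun x => ((f i x + f j x) / 2) ^ p) μ := by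
    intro i j
    have hm : MemLp (fun x => (f i x + f j x) / 2) q μ := by
      have := ((hf i).add (hf j)).const_mul (1 / 2)
      refine this.ae_eq (Eventually.of_forall fun x => ?_)
      simp only [Pi.add_apply]; ring
    refine (hm.integrable_norm_rpow hq0 hqt).congr ?_
    filter_upwards [hf0 i, hf0 j] with x hx hy
    rw [Real.norm_of_nonneg (by positivity)]
  have hbound : ∀ δ > 0, ∃ N, ∀ i ≥ N, ∀ j ≥ N, ∫ x, |f i x - f j x| ^ p ∂μ ≤ δ := by
    intro δ hδ
    have hB0 : 0 ≤ B := le_trans (integral_nonneg_of_ae (by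
      filter_upwards [hf0 0] with x hx using Real.rpow_nonneg hx _)) (hB 0)
    -- The two tolerances are chosen so that the `ε` term and the defect term each contribute at
    -- most `δ / 2`.
    obtain ⟨K, hK0, hK⟩ := exists_abs_sub_rpow_le hq1 (ε := δ / (4 * (B + 1))) (by positivity)
    obtain ⟨N, hN⟩ := hdef (δ / (2 * (K + 1))) (by positivity)
    refine ⟨N, fun i hi j hj => ?_⟩
    have hsub : MemLp (fun x => f i x - f j x) q μ := (hf i).sub (hf j)
    have hI1 : Integrable (fun x => δ / (4 * (B + 1)) * (f i x ^ p + f j x ^ p)) μ :=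
      ((hint i).add (hint j)).const_mul _
    have hI2 : Integrable (fun x => (f i x ^ p + f j x ^ p) / 2) μ :=
      ((hint i).add (hint j)).div_const 2
    have hI3 : Integrable
        (fun x => K * ((f i x ^ p + f j x ^ p) / 2 - ((f i x + f j x) / 2) ^ p)) μ :=
      (hI2.sub (hmid i j)).const_mul K
    calc ∫ x, |f i x - f j x| ^ p ∂μ
        ≤ ∫ x, (δ / (4 * (B + 1)) * (f i x ^ p + f j x ^ p)
            + K * ((f i x ^ p + f j x ^ p) / 2 - ((f i x + f j x) / 2) ^ p)) ∂μ := by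
          refine integral_mono_ae (by simpa using hsub.integrable_norm_rpow hq0 hqt) (hI1.add hI3) ?_
          filter_upwards [hf0 i, hf0 j] with x hx hy 
          exact hK _ _ hx hy
      _ = δ / (4 * (B + 1)) * (∫ x, f i x ^ p ∂μ + ∫ x, f j x ^ p ∂μ)
            + K * ((∫ x, f i x ^ p ∂μ + ∫ x, f j x ^ p ∂μ) / 2
              - ∫ x, ((f i x + f j x) / 2) ^ p ∂μ) := by
          rw [integral_add hI1 hI3, integral_const_mul, integral_const_mul, integral_sub hI2 (hmid i j), integral_div, integral_add (hint i) (hint j)]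
      _ ≤ δ / (4 * (B + 1)) * (B + B) + K * (δ / (2 * (K + 1))) := by
          gcongr
          · exact hB i
          · exact hB j
          · exact hN i hi j hj
      _ ≤ δ := by
          have h1 : δ / (4 * (B + 1)) * (B + B) ≤ δ / 2 := by
            rw [div_mul_eq_mul_div, div_le_div_iff₀ (by positivity) (by norm_num)]
            nlinarith
          have h2 : K * (δ / (2 * (K + 1))) ≤ δ / 2 := by
            rw [mul_div_assoc', div_le_div_iff₀ (by positivity) (by norm_num)]
            nlinarith
          linarith
  have hcau : CauchySeq fun n => (hf n).toLp (f n) := by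
    rw [Metric.cauchySeq_iff]
    intro ε hε
    obtain ⟨N, hN⟩ := hbound ((ε / 2) ^ p) (by positivity)
    refine ⟨N, fun i hi j hj => ?_⟩
    have hsub : MemLp (f i - f j) q μ := (hf i).sub (hf j)
    rw [dist_edist, Lp.edist_toLp_toLp, hsub.eLpNorm_eq_integral_rpow_norm hq0 hqt,
      ENNReal.toReal_ofReal (by positivity)]
    have h1 : ∫ x, ‖(f i - f j) x‖ ^ q.toReal ∂μ ≤ (ε / 2) ^ p := by simpa using hN i hi j hj
    have h2 : (∫ x, ‖(f i - f j) x‖ ^ q.toReal ∂μ) ^ (q.toReal)⁻¹ ≤ ((ε / 2) ^ p) ^ p⁻¹ :=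
      Real.rpow_le_rpow (by positivity) h1 (by positivity)
    rw [Real.rpow_rpow_inv (by positivity) hp0.ne'] at h2
    linarith
  obtain ⟨g, hg⟩ := cauchySeq_tendsto_of_complete hcau
  refine ⟨g, Lp.memLp g, ?_⟩
  rw [← Lp.tendsto_Lp_iff_tendsto_eLpNorm'' f hf g (Lp.memLp g)]
  simpa using hg

/-! ### Helly's selection theorem -/

/-- **Helly's selection theorem** for uniformly bounded sequences of monotone functions. -/
theorem exists_subseq_tendsto_of_monotone {m : ℕ → ℝ → ℝ} (hm : ∀ j, Monotone (m j)) {a b : ℝ}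
    (hab : ∀ j r, m j r ∈ Set.Icc a b) :
    ∃ (s : ℕ → ℕ) (F : ℝ → ℝ) (S : Set ℝ), StrictMono s ∧ S.Countable ∧
      ∀ r ∉ S, Tendsto (fun j => m (s j) r) atTop (𝓝 (F r)) := by
  have hcomp : IsCompact (Set.pi Set.univ fun _ : ℚ => Set.Icc a b) :=
    isCompact_univ_pi fun _ => isCompact_Icc
  obtain ⟨μ, hμ, s, hs, hlim⟩ := hcomp.tendsto_subseq (x := fun j (q : ℚ) => m j q)
    (fun j q _ => hab j q)
  have hlim' : ∀ q : ℚ, Tendsto (fun j => m (s j) q) atTop (𝓝 (μ q)) := fun q =>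
    (tendsto_pi_nhds.1 hlim) q
  -- The limit along rationals is extended to a monotone function on `ℝ`, whose discontinuities are
  -- countable. At a continuity point the values are squeezed between those at nearby rationals.
  set F : ℝ → ℝ := fun r => sInf (μ '' {q : ℚ | r < q}) with hF
  have hbdd : ∀ r : ℝ, BddBelow (μ '' {q : ℚ | r < q}) := fun r =>
    ⟨a, by rintro _ ⟨q, -, rfl⟩; exact (hμ q trivial).1⟩
  have hne : ∀ r : ℝ, (μ '' {q : ℚ | r < q}).Nonempty := fun r =>
    let ⟨q, hq⟩ := exists_rat_gt r
    ⟨_, q, hq, rfl⟩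
  have hFle : ∀ (r : ℝ) (q : ℚ), r < q → F r ≤ μ q := fun r q h => csInf_le (hbdd r) ⟨q, h, rfl⟩
  have hleF : ∀ (r : ℝ) (q : ℚ), q ≤ r → μ q ≤ F r := by
    intro r q h
    refine le_csInf (hne r) ?_
    rintro _ ⟨q', hq', rfl⟩
    exact le_of_tendsto_of_tendsto' (hlim' q) (hlim' q') fun j => hm _ (h.trans (le_of_lt hq'))
  have hFmono : Monotone F := fun r r' h =>
    csInf_le_csInf (hbdd r) (hne r') (Set.image_mono fun q hq => lt_of_le_of_lt h hq)
  refine ⟨s, F, {r | ¬ ContinuousAt F r}, hs, hFmono.countable_not_continuousAt, fun r hr => ?_⟩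
  have hcont : ContinuousAt F r := not_not.1 hr
  rw [Metric.tendsto_atTop]
  intro ε hε
  obtain ⟨δ, hδ, hFδ⟩ := Metric.continuousAt_iff.1 hcont (ε / 2) (by positivity)
  obtain ⟨q₁, h1, h1'⟩ := exists_rat_btwn (show r - δ / 2 < r by linarith)
  obtain ⟨q₂, h2, h2'⟩ := exists_rat_btwn (show r < r + δ / 2 by linarith)
  have hA := hFδ (x := r - δ / 2) (by rw [Real.dist_eq, abs_lt]; constructor <;> linarith)
  have hC := hFδ (x := r + δ / 2) (by rw [Real.dist_eq, abs_lt]; constructor <;> linarith)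
  rw [Real.dist_eq, abs_lt] at hA hC
  obtain ⟨N1, hN1⟩ := Metric.tendsto_atTop.1 (hlim' q₁) (ε / 2) (by positivity)
  obtain ⟨N2, hN2⟩ := Metric.tendsto_atTop.1 (hlim' q₂) (ε / 2) (by positivity)
  refine ⟨max N1 N2, fun j hj => ?_⟩
  have e1 := hN1 j (le_of_max_le_left hj)
  have e2 := hN2 j (le_of_max_le_right hj)
  rw [Real.dist_eq, abs_lt] at e1 e2 ⊢
  have m1 := hm (s j) h1'.le
  have m2 := hm (s j) h2.le
  have l1 := hFle _ _ h1
  have l2 := hleF _ _ h2'.le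
  constructor <;> linarith

/-! ### Square integrability and convergence of radial fields -/

/-- The radial vector field with the field strength of the enclosed mass `m`. -/
noncomputable def radialField (m : ℝ → ℝ) (x : R3) : R3 := (m ‖x‖ / ‖x‖ ^ 2) • (‖x‖⁻¹ • x)

theorem gradU_eq_radialField (f : Phase → ℝ) : gradU f = radialField (massIn (rho f)) := rfl

theorem norm_radialField (m : ℝ → ℝ) (x : R3) : ‖radialField m x‖ = |m ‖x‖| / ‖x‖ ^ 2 := by
  rcases eq_or_ne x 0 with rfl | hx
  · simp [radialField]
  · have : ‖x‖ ≠ 0 := norm_ne_zero_iff.2 hx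
    rw [radialField, norm_smul, norm_smul, norm_inv, norm_norm, inv_mul_cancel₀ this, mul_one,
      norm_div, norm_pow, norm_norm, Real.norm_eq_abs]

theorem radialField_sub (m m' : ℝ → ℝ) :
    radialField m - radialField m' = radialField (m - m') := by
  ext1 x
  simp only [radialField, Pi.sub_apply, sub_div, sub_smul]

theorem radialField_smul (c : ℝ) (m : ℝ → ℝ) : radialField (c • m) = c • radialField m := by
  ext1 x
  simp only [radialField, Pi.smul_apply, smul_eq_mul, mul_div_assoc, mul_smul]

theorem radialField_add (m m' : ℝ → ℝ) :
    radialField (m + m') = radialField m + radialField m' := by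
  ext1 x
  simp only [radialField, Pi.add_apply, add_div, add_smul]

theorem measurable_radialField {m : ℝ → ℝ} (hm : Measurable m) : Measurable (radialField m) := by
  unfold radialField
  fun_prop

/-- The quadratic bound on `m` controls the field near the origin, the constant bound controls it at
infinity. In the variable `s = √A |x|` the crossover is placed at `s = 1`, and the decay `s⁻⁴` is
integrable in dimension three. -/
theorem norm_radialField_sq_le {m : ℝ → ℝ} {A M : ℝ} (hA : 0 < A)
    (h1 : ∀ r, 0 ≤ r → |m r| ≤ M) (h2 : ∀ r, 0 ≤ r → |m r| ≤ A * r ^ 2) (x : R3) :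
    ‖radialField m x‖ ^ 2 ≤
      16 * max 1 M ^ 2 * A ^ 2 * (1 + ‖√A • x‖) ^ (-4 : ℝ) := by
  set s := √A * ‖x‖ with hs
  have hs0 : 0 ≤ s := by positivity
  have hsA : s ^ 2 = A * ‖x‖ ^ 2 := by rw [hs, mul_pow, Real.sq_sqrt hA.le]
  have hn : ‖√A • x‖ = s := by rw [norm_smul, Real.norm_of_nonneg (Real.sqrt_nonneg _)]
  have hpow : (1 + s) ^ (-4 : ℝ) = (((1 + s) ^ 2)⁻¹) ^ 2 := by
    rw [Real.rpow_neg (by positivity), inv_pow, ← pow_mul]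
    norm_cast
  rw [hn, hpow, norm_radialField]
  have hX : 1 ≤ max 1 M := le_max_left _ _
  have hXM : M ≤ max 1 M := le_max_right _ _
  have key : |m ‖x‖| / ‖x‖ ^ 2 ≤ 4 * max 1 M * A * ((1 + s) ^ 2)⁻¹ := by
    rcases eq_or_ne x 0 with rfl | hx
    · simp only [norm_zero, ne_eq, OfNat.ofNat_ne_zero, not_false_eq_true, zero_pow, div_zero]
      positivity
    · have hx0 : 0 < ‖x‖ := norm_pos_iff.2 hx
      rw [← div_eq_mul_inv, div_le_div_iff₀ (by positivity) (by positivity)]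
      have a1 := h1 ‖x‖ hx0.le
      have a2 := h2 ‖x‖ hx0.le
      rw [← hsA] at a2
      have e : 4 * max 1 M * A * ‖x‖ ^ 2 = 4 * max 1 M * s ^ 2 := by rw [hsA]; ring
      rw [e]
      rcases le_total s 1 with h | h
      · calc |m ‖x‖| * (1 + s) ^ 2 ≤ s ^ 2 * 2 ^ 2 := by gcongr; linarith
          _ ≤ 4 * max 1 M * s ^ 2 := by nlinarith [sq_nonneg s]
      · calc |m ‖x‖| * (1 + s) ^ 2 ≤ max 1 M * (s + s) ^ 2 := by
              gcongr; exact a1.trans hXM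
          _ = 4 * max 1 M * s ^ 2 := by ring
  calc (|m ‖x‖| / ‖x‖ ^ 2) ^ 2 ≤ (4 * max 1 M * A * ((1 + s) ^ 2)⁻¹) ^ 2 := by gcongr
    _ = _ := by ring

theorem integrable_one_add_norm_rpow_neg_four :
    Integrable (fun x : R3 => (1 + ‖x‖) ^ (-4 : ℝ)) :=
  integrable_one_add_norm (by simp; norm_num)

theorem integrable_radialField_bound (M : ℝ) {A : ℝ} (hA : 0 < A) :
    Integrable (fun x : R3 => 16 * max 1 M ^ 2 * A ^ 2 * (1 + ‖√A • x‖) ^ (-4 : ℝ)) :=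
  (integrable_one_add_norm_rpow_neg_four.comp_smul (Real.sqrt_pos.2 hA).ne').const_mul _

theorem integrable_norm_radialField_sq {m : ℝ → ℝ} (hm : Measurable m) {A M : ℝ} (hA : 0 < A)
    (h1 : ∀ r, 0 ≤ r → |m r| ≤ M) (h2 : ∀ r, 0 ≤ r → |m r| ≤ A * r ^ 2) :
    Integrable (fun x : R3 => ‖radialField m x‖ ^ 2) := by
  refine (integrable_radialField_bound M hA).mono'
    ((measurable_radialField hm).norm.pow_const 2).aestronglyMeasurable
    (Eventually.of_forall fun x => ?_)
  rw [Real.norm_of_nonneg (by positivity)]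
  exact norm_radialField_sq_le hA h1 h2 x

/-- Rescaling turns `A²` into `A² A^(-3/2) = √A`. This sublinear growth is what lets the kinetic
energy dominate the field energy. -/
theorem integral_norm_radialField_sq_le {m : ℝ → ℝ} (hm : Measurable m) {A M : ℝ} (hA : 0 < A)
    (h1 : ∀ r, 0 ≤ r → |m r| ≤ M) (h2 : ∀ r, 0 ≤ r → |m r| ≤ A * r ^ 2) :
    ∫ x : R3, ‖radialField m x‖ ^ 2 ≤
      16 * max 1 M ^ 2 * (∫ x : R3, (1 + ‖x‖) ^ (-4 : ℝ)) * √A := by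
  refine (integral_mono (integrable_norm_radialField_sq hm hA h1 h2)
    (integrable_radialField_bound M hA) (norm_radialField_sq_le hA h1 h2)).trans_eq ?_
  rw [integral_const_mul,
    Measure.integral_comp_smul volume (fun x : R3 => (1 + ‖x‖) ^ (-4 : ℝ)) (√A)]
  have hs : 0 < √A := Real.sqrt_pos.2 hA
  simp only [finrank_euclideanSpace, Fintype.card_fin, smul_eq_mul]
  rw [abs_of_pos (by positivity)]
  have e : A ^ 2 = √A ^ 3 * √A := by
    nth_rewrite 1 [← Real.sq_sqrt hA.le]
    ring
  rw [e]
  field_simp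

theorem memLp_radialField {m : ℝ → ℝ} (hm : Measurable m) {A M : ℝ} (hA : 0 < A)
    (h1 : ∀ r, 0 ≤ r → |m r| ≤ M) (h2 : ∀ r, 0 ≤ r → |m r| ≤ A * r ^ 2) :
    MemLp (radialField m) 2 volume := by
  rw [memLp_two_iff_integrable_sq_norm (measurable_radialField hm).aestronglyMeasurable]
  exact integrable_norm_radialField_sq hm hA h1 h2

/-- Dominated convergence for radial fields. -/
theorem tendsto_integral_norm_radialField_sq {ι : Type*} {u : Filter ι} [u.IsCountablyGenerated]
    {m : ι → ℝ → ℝ} {m' : ℝ → ℝ} (hm : ∀ i, Measurable (m i)) {A M : ℝ} (hA : 0 < A)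
    (h1 : ∀ i r, 0 ≤ r → |m i r| ≤ M) (h2 : ∀ i r, 0 ≤ r → |m i r| ≤ A * r ^ 2)
    {S : Set ℝ} (hS : S.Countable) (hlim : ∀ r ∉ S, Tendsto (fun i => m i r) u (𝓝 (m' r))) :
    Tendsto (fun i => ∫ x : R3, ‖radialField (m i) x‖ ^ 2) u
      (𝓝 (∫ x : R3, ‖radialField m' x‖ ^ 2)) := by
  have hnull : ∀ᵐ x : R3, ‖x‖ ∉ S := by
    have : ∀ r ∈ S, ∀ᵐ x : R3, ‖x‖ ≠ r := by
      intro r _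
      have h := Measure.addHaar_sphere (volume : Measure R3) (0 : R3) r
      rw [measure_eq_zero_iff_ae_notMem] at h
      filter_upwards [h] with x hx hr
      exact hx (by simp [hr])
    filter_upwards [(ae_ball_iff hS).2 this] with x hx hmem
    exact hx _ hmem rfl
  refine tendsto_integral_filter_of_dominated_convergence
    (fun x : R3 => 16 * max 1 M ^ 2 * A ^ 2 * (1 + ‖√A • x‖) ^ (-4 : ℝ)) ?_ ?_
    (integrable_radialField_bound M hA) ?_
  · exact Eventually.of_forall fun i =>
      ((measurable_radialField (hm i)).norm.pow_const 2).aestronglyMeasurable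
  · refine Eventually.of_forall fun i => Eventually.of_forall fun x => ?_
    rw [Real.norm_of_nonneg (by positivity)]
    exact norm_radialField_sq_le hA (h1 i) (h2 i) x
  · filter_upwards [hnull] with x hx
    have h := ((hlim _ hx).abs.div_const (‖x‖ ^ 2)).pow 2
    simpa [norm_radialField] using h

theorem radialField_zero : radialField 0 = 0 := by
  ext1 x
  simp [radialField]

theorem eLpNorm_two_eq_ofReal_sqrt {F : R3 → R3} (hF : MemLp F 2 volume) :
    eLpNorm F 2 volume = ENNReal.ofReal (√(∫ x : R3, ‖F x‖ ^ 2)) := by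
  rw [hF.eLpNorm_eq_integral_rpow_norm (by norm_num) (by norm_num), Real.sqrt_eq_rpow]
  norm_num

/-! ### The weight and the angular momentum cutoff -/

section Weight

variable {k l L₀ : ℝ}

theorem continuous_angMomSq : Continuous angMomSq := by
  unfold angMomSq
  fun_prop

theorem measurable_weight : Measurable (weight k l L₀) :=
  ((continuous_angMomSq.measurable.sub_const L₀).ennreal_ofReal).pow_const _

theorem weight_ne_zero (hk : 0 < k) (hl : 0 < l) (z : Phase) : weight k l L₀ z ≠ 0 := by
  have : 0 < l / k := by positivity
  simp [weight, ENNReal.rpow_eq_zero_iff, this, this.le]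

theorem weightedMeasure_ac : weightedMeasure k l L₀ ≪ volume := withDensity_absolutelyContinuous _ _

theorem volume_ac_weightedMeasure (hk : 0 < k) (hl : 0 < l) :
    (volume : Measure Phase) ≪ weightedMeasure k l L₀ :=
  withDensity_absolutelyContinuous' measurable_weight.aemeasurable
    (Eventually.of_forall fun z => weight_ne_zero hk hl z)

theorem expo_ne_top : expo k ≠ ∞ := by simp [expo]

theorem expo_ne_zero : expo k ≠ 0 := by simp [expo]

theorem toReal_expo (hk : 0 < k) : (expo k).toReal = 1 + 1 / k := by
  rw [expo, ENNReal.toReal_add (by simp) (by simp), ENNReal.toReal_ofReal (by positivity)]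
  simp

theorem angMomSq_le (z : Phase) : angMomSq z ≤ ‖z.1‖ ^ 2 * ‖z.2‖ ^ 2 := by
  unfold angMomSq
  nlinarith [sq_nonneg (inner ℝ z.1 z.2)]

theorem inv_norm_sq_le (hL₀ : 0 < L₀) {z : Phase} (hz : L₀ ≤ angMomSq z) :
    (‖z.1‖⁻¹) ^ 2 ≤ ‖z.2‖ ^ 2 / L₀ := by
  have h := hz.trans (angMomSq_le z)
  have h0 : 0 < ‖z.1‖ ^ 2 := by
    by_contra hcon
    have : ‖z.1‖ ^ 2 = 0 := le_antisymm (not_lt.1 hcon) (by positivity)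
    rw [this] at h
    linarith
  rw [inv_pow, le_div_iff₀ hL₀, inv_mul_le_iff₀ h0]
  exact h

end Weight

/-! ### Real-valued functionals and a priori bounds for admissible functions -/

/-- The second velocity moment, twice the kinetic energy. -/
noncomputable def kin (f : Phase → ℝ) : ℝ := ∫ z : Phase, ‖z.2‖ ^ 2 * f z

/-- The moment `∬ f / |x|`. -/
noncomputable def invMoment (f : Phase → ℝ) : ℝ := ∫ z : Phase, ‖z.1‖⁻¹ * f z

/-- The Casimir functional as a real number. -/
noncomputable def cas (k l L₀ : ℝ) (f : Phase → ℝ) : ℝ :=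
  ∫ z, f z ^ (expo k).toReal ∂weightedMeasure k l L₀

/-- The squared `L²` norm of the field. -/
noncomputable def fieldSq (f : Phase → ℝ) : ℝ := ∫ x : R3, ‖gradU f x‖ ^ 2

/-- The energy-Casimir functional as a real number. -/
noncomputable def energyReal (k l L₀ Mc : ℝ) (f : Phase → ℝ) : ℝ :=
  1 / 2 * kin f + cas k l L₀ f - (1 / (8 * Real.pi) * fieldSq f + Mc * invMoment f)

theorem massIn_rho {f : Phase → ℝ} (hf : Integrable f) (r : ℝ) :
    massIn (rho f) r = ∫ z in Metric.closedBall (0 : R3) r ×ˢ Set.univ, f z := by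
  rw [Measure.volume_eq_prod, setIntegral_prod _ (by
    rw [← Measure.volume_eq_prod]; exact hf.integrableOn)]
  simp [massIn, rho]

theorem casimir_eq_lintegral {k l L₀ : ℝ} (hk : 0 < k) {f : Phase → ℝ}
    (hf : AEStronglyMeasurable f) (hf0 : ∀ᵐ z : Phase, 0 ≤ f z) :
    casimir k l L₀ f = ∫⁻ z, ‖f z‖ₑ ^ (expo k).toReal ∂weightedMeasure k l L₀ := by
  rw [weightedMeasure, lintegral_withDensity_eq_lintegral_mul₀ measurable_weight.aemeasurable
    (hf.enorm.pow_const _), casimir]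
  refine lintegral_congr_ae ?_
  filter_upwards [hf0] with z hz
  rw [toReal_expo hk, Pi.mul_apply, mul_comm, Real.enorm_of_nonneg hz]

namespace Admissible

variable {k l L₀ M : ℝ} {f : Phase → ℝ}

theorem ae_weighted_nonneg (hf : Admissible k l L₀ M f) :
    ∀ᵐ z ∂weightedMeasure k l L₀, 0 ≤ f z :=
  weightedMeasure_ac.ae_le hf.nonneg

theorem ae_le_angMomSq (hf : Admissible k l L₀ M f) :
    ∀ᵐ z : Phase, f z ≠ 0 → L₀ ≤ angMomSq z := by
  filter_upwards [hf.vanish] with z hz h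
  exact not_lt.1 fun hlt => h (hz hlt)

theorem integrable_kin (hf : Admissible k l L₀ M f) :
    Integrable (fun z : Phase => ‖z.2‖ ^ 2 * f z) := by
  have hm : AEStronglyMeasurable (fun z : Phase => 1 / 2 * ‖z.2‖ ^ 2 * f z) :=
    (by fun_prop : Continuous fun z : Phase => 1 / 2 * ‖z.2‖ ^ 2).aestronglyMeasurable.mul
      hf.integrable.1
  have h : Integrable (fun z : Phase => 1 / 2 * ‖z.2‖ ^ 2 * f z) := by
    refine ⟨hm, ?_⟩
    rw [hasFiniteIntegral_iff_ofReal]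
    · exact lt_of_le_of_lt le_self_add hf.finite
    · filter_upwards [hf.nonneg] with z hz
      simp only [Pi.zero_apply]
      positivity
  refine (h.const_mul 2).congr (Eventually.of_forall fun z => ?_)
  ring

theorem eKin_eq (hf : Admissible k l L₀ M f) : eKin f = ENNReal.ofReal (1 / 2 * kin f) := by
  rw [kin, ← integral_const_mul, ofReal_integral_eq_lintegral_ofReal (hf.integrable_kin.const_mul _)]
  · simp only [eKin, mul_assoc]
  · filter_upwards [hf.nonneg] with z hz
    simp only [Pi.zero_apply]
    positivity

theorem kin_nonneg (hf : Admissible k l L₀ M f) : 0 ≤ kin f :=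
  integral_nonneg_of_ae (by filter_upwards [hf.nonneg] with z hz; simp only [Pi.zero_apply]; positivity)

theorem mass_nonneg (hf : Admissible k l L₀ M f) : 0 ≤ M :=
  hf.mass ▸ integral_nonneg_of_ae hf.nonneg

theorem memLp (hf : Admissible k l L₀ M f) (hk : 0 < k) :
    MemLp f (expo k) (weightedMeasure k l L₀) := by
  refine ⟨hf.integrable.1.mono_ac weightedMeasure_ac, ?_⟩
  rw [eLpNorm_lt_top_iff_lintegral_rpow_enorm_lt_top expo_ne_zero expo_ne_top,
    ← casimir_eq_lintegral hk hf.integrable.1 hf.nonneg]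
  exact lt_of_le_of_lt le_add_self hf.finite

theorem memLkl (hf : Admissible k l L₀ M f) (hk : 0 < k) : MemLkl k l L₀ f :=
  ⟨hf.memLp hk, hf.sphSymm⟩

end Admissible

theorem integrable_rpow_expo {k l L₀ : ℝ} {f : Phase → ℝ}
    (hf : MemLp f (expo k) (weightedMeasure k l L₀)) (hf0 : ∀ᵐ z : Phase, 0 ≤ f z) :
    Integrable (fun z => f z ^ (expo k).toReal) (weightedMeasure k l L₀) := by
  refine (hf.integrable_norm_rpow expo_ne_zero expo_ne_top).congr ?_
  filter_upwards [weightedMeasure_ac.ae_le hf0] with z hz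
  rw [Real.norm_of_nonneg hz]

theorem casimir_eq_ofReal {k l L₀ : ℝ} (hk : 0 < k) {f : Phase → ℝ}
    (hfm : AEStronglyMeasurable f) (hf : MemLp f (expo k) (weightedMeasure k l L₀))
    (hf0 : ∀ᵐ z : Phase, 0 ≤ f z) : casimir k l L₀ f = ENNReal.ofReal (cas k l L₀ f) := by
  have h0 : ∀ᵐ z ∂weightedMeasure k l L₀, 0 ≤ f z := weightedMeasure_ac.ae_le hf0
  rw [casimir_eq_lintegral hk hfm hf0, cas, ofReal_integral_eq_lintegral_ofReal
    (integrable_rpow_expo hf hf0)]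
  · refine lintegral_congr_ae ?_
    filter_upwards [h0] with z hz
    rw [Real.enorm_of_nonneg hz, ENNReal.ofReal_rpow_of_nonneg hz ENNReal.toReal_nonneg]
  · filter_upwards [h0] with z hz using Real.rpow_nonneg hz _

theorem cas_nonneg {k l L₀ : ℝ} {f : Phase → ℝ} (hf0 : ∀ᵐ z : Phase, 0 ≤ f z) :
    0 ≤ cas k l L₀ f :=
  integral_nonneg_of_ae (by
    filter_upwards [weightedMeasure_ac.ae_le hf0] with z hz using Real.rpow_nonneg hz _)

/-- Admissibility in terms of integrability conditions. -/
theorem Admissible.of_integrable {k l L₀ M : ℝ} (hk : 0 < k) {f : Phase → ℝ} (hf : Integrable f)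
    (hf0 : ∀ᵐ z : Phase, 0 ≤ f z) (hs : SphSymm f) (hM : ∫ z : Phase, f z = M)
    (hkin : Integrable fun z : Phase => ‖z.2‖ ^ 2 * f z)
    (hcas : MemLp f (expo k) (weightedMeasure k l L₀))
    (hv : ∀ᵐ z : Phase, angMomSq z < L₀ → f z = 0) : Admissible k l L₀ M f := by
  refine ⟨hf, hf0, hs, hM, ENNReal.add_lt_top.2 ⟨?_, ?_⟩, hv⟩
  · have := (hkin.const_mul (1 / 2)).lintegral_lt_top
    simpa only [eKin, mul_assoc] using this
  · rw [casimir_eq_ofReal hk hf.1 hcas hf0]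
    exact ENNReal.ofReal_lt_top

namespace Admissible

variable {k l L₀ M : ℝ} {f : Phase → ℝ}

/-- Young's inequality `t ≤ δ t² + 1/(4δ)` with `t = 1/|x|`, where `t² ≤ |v|²/L₀` on the support.
The free `δ` makes the kinetic share as small as desired. -/
theorem ae_inv_norm_le (hf : Admissible k l L₀ M f) (hL₀ : 0 < L₀) {δ : ℝ} (hδ : 0 < δ) :
    ∀ᵐ z : Phase, ‖z.1‖⁻¹ * f z ≤ δ / L₀ * (‖z.2‖ ^ 2 * f z) + 1 / (4 * δ) * f z := by
  filter_upwards [hf.nonneg, hf.ae_le_angMomSq] with z h0 h1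
  rcases eq_or_ne (f z) 0 with h | h
  · simp [h]
  · have h2 := inv_norm_sq_le hL₀ (h1 h)
    set t := ‖z.1‖⁻¹
    have h3 : t ≤ δ * t ^ 2 + 1 / (4 * δ) := by
      have : 0 ≤ (2 * δ * t - 1) ^ 2 / (4 * δ) := by positivity
      have e : (2 * δ * t - 1) ^ 2 / (4 * δ) = δ * t ^ 2 + 1 / (4 * δ) - t := by
        field_simp; ring
      linarith
    calc t * f z ≤ (δ * (‖z.2‖ ^ 2 / L₀) + 1 / (4 * δ)) * f z := by
          gcongr
          exact h3.trans (by gcongr)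
      _ = _ := by ring

theorem integrable_inv (hf : Admissible k l L₀ M f) (hL₀ : 0 < L₀) :
    Integrable (fun z : Phase => ‖z.1‖⁻¹ * f z) := by
  refine ((hf.integrable_kin.const_mul (1 / L₀)).add (hf.integrable.const_mul (1 / (4 * 1)))).mono'
    ((by fun_prop : Measurable fun z : Phase => ‖z.1‖⁻¹).aestronglyMeasurable.mul
      hf.integrable.1) ?_
  filter_upwards [hf.ae_inv_norm_le hL₀ one_pos, hf.nonneg] with z h h0
  rw [Real.norm_of_nonneg (by positivity)]
  exact h

theorem invMoment_nonneg (hf : Admissible k l L₀ M f) : 0 ≤ invMoment f :=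
  integral_nonneg_of_ae (by filter_upwards [hf.nonneg] with z hz; simp only [Pi.zero_apply]; positivity)

theorem invMoment_le (hf : Admissible k l L₀ M f) (hL₀ : 0 < L₀) {δ : ℝ} (hδ : 0 < δ) :
    invMoment f ≤ δ / L₀ * kin f + 1 / (4 * δ) * M := by
  rw [← hf.mass, kin, ← integral_const_mul, ← integral_const_mul,
    ← integral_add (hf.integrable_kin.const_mul _) (hf.integrable.const_mul _)]
  exact integral_mono_ae (hf.integrable_inv hL₀)
    ((hf.integrable_kin.const_mul _).add (hf.integrable.const_mul _)) (hf.ae_inv_norm_le hL₀ hδ)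

theorem massIn_nonneg (hf : Admissible k l L₀ M f) (r : ℝ) : 0 ≤ massIn (rho f) r := by
  rw [massIn_rho hf.integrable]
  exact integral_nonneg_of_ae (ae_restrict_of_ae hf.nonneg)

theorem massIn_mono (hf : Admissible k l L₀ M f) : Monotone (massIn (rho f)) := by
  intro r s hrs
  rw [massIn_rho hf.integrable, massIn_rho hf.integrable]
  exact setIntegral_mono_set hf.integrable.integrableOn (ae_restrict_of_ae hf.nonneg)
    (Set.prod_mono (Metric.closedBall_subset_closedBall hrs) subset_rfl).eventuallyLE

theorem massIn_le (hf : Admissible k l L₀ M f) (r : ℝ) : massIn (rho f) r ≤ M := by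
  rw [massIn_rho hf.integrable, ← hf.mass]
  exact setIntegral_le_integral hf.integrable hf.nonneg

/-- For `|x| ≤ r` in the support, `L₀ ≤ r² |v|²`, so mass near the centre must be fast and is paid
for by kinetic energy. -/
theorem massIn_le_sq (hf : Admissible k l L₀ M f) (hL₀ : 0 < L₀) (r : ℝ) :
    massIn (rho f) r ≤ kin f / L₀ * r ^ 2 := by
  have hS : MeasurableSet (Metric.closedBall (0 : R3) r ×ˢ (Set.univ : Set R3)) :=
    measurableSet_closedBall.prod MeasurableSet.univ
  rw [massIn_rho hf.integrable]
  have hI : Integrable (fun z : Phase => r ^ 2 / L₀ * (‖z.2‖ ^ 2 * f z)) :=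
    hf.integrable_kin.const_mul _
  have hnn : ∀ᵐ z : Phase, 0 ≤ r ^ 2 / L₀ * (‖z.2‖ ^ 2 * f z) := by
    filter_upwards [hf.nonneg] with z hz
    positivity
  calc ∫ z in Metric.closedBall (0 : R3) r ×ˢ Set.univ, f z
      ≤ ∫ z in Metric.closedBall (0 : R3) r ×ˢ Set.univ, r ^ 2 / L₀ * (‖z.2‖ ^ 2 * f z) := by
        refine setIntegral_mono_on_ae hf.integrable.integrableOn hI.integrableOn hS ?_
        filter_upwards [hf.nonneg, hf.ae_le_angMomSq] with z h0 h1 hz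
        rcases eq_or_ne (f z) 0 with h | h
        · simp [h]
        · have h2 := (h1 h).trans (angMomSq_le z)
          have h3 : ‖z.1‖ ≤ r := by simpa using hz.1
          rw [div_mul_eq_mul_div, le_div_iff₀ hL₀]
          calc f z * L₀ ≤ f z * (r ^ 2 * ‖z.2‖ ^ 2) := by
                gcongr
                exact h2.trans (by gcongr)
            _ = _ := by ring
    _ ≤ ∫ z : Phase, r ^ 2 / L₀ * (‖z.2‖ ^ 2 * f z) := setIntegral_le_integral hI hnn
    _ = kin f / L₀ * r ^ 2 := by rw [integral_const_mul, kin]; ring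

theorem abs_massIn_le (hf : Admissible k l L₀ M f) (r : ℝ) : |massIn (rho f) r| ≤ M := by
  rw [abs_of_nonneg (hf.massIn_nonneg r)]
  exact hf.massIn_le r

theorem abs_massIn_le_sq (hf : Admissible k l L₀ M f) (hL₀ : 0 < L₀) {A : ℝ}
    (hA : kin f / L₀ ≤ A) (r : ℝ) : |massIn (rho f) r| ≤ A * r ^ 2 := by
  rw [abs_of_nonneg (hf.massIn_nonneg r)]
  exact (hf.massIn_le_sq hL₀ r).trans (by gcongr)

theorem integrable_gradU_sq (hf : Admissible k l L₀ M f) (hL₀ : 0 < L₀) :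
    Integrable (fun x : R3 => ‖gradU f x‖ ^ 2) := by
  have := hf.kin_nonneg
  -- The summand 1 keeps `A` positive even when the kinetic energy vanishes.
  exact integrable_norm_radialField_sq hf.massIn_mono.measurable
    (A := kin f / L₀ + 1) (by positivity) (fun r _ => hf.abs_massIn_le r)
    (fun r _ => hf.abs_massIn_le_sq hL₀ (by linarith) r)

theorem memLp_gradU (hf : Admissible k l L₀ M f) (hL₀ : 0 < L₀) : MemLp (gradU f) 2 volume := by
  have := hf.kin_nonneg
  exact memLp_radialField hf.massIn_mono.measurable
    (A := kin f / L₀ + 1) (by positivity) (fun r _ => hf.abs_massIn_le r)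
    (fun r _ => hf.abs_massIn_le_sq hL₀ (by linarith) r)

theorem fieldSq_le (hf : Admissible k l L₀ M f) (hL₀ : 0 < L₀) :
    fieldSq f ≤ 16 * max 1 M ^ 2 * (∫ x : R3, (1 + ‖x‖) ^ (-4 : ℝ)) * √(kin f / L₀ + 1) := by
  have := hf.kin_nonneg
  exact integral_norm_radialField_sq_le hf.massIn_mono.measurable
    (A := kin f / L₀ + 1) (by positivity) (fun r _ => hf.abs_massIn_le r)
    (fun r _ => hf.abs_massIn_le_sq hL₀ (by linarith) r)

theorem negEPot_eq (hf : Admissible k l L₀ M f) (hL₀ : 0 < L₀) {Mc : ℝ} (hMc : 0 < Mc) :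
    negEPot Mc f = ENNReal.ofReal (1 / (8 * Real.pi) * fieldSq f + Mc * invMoment f) := by
  have hint := hf.integrable_inv hL₀
  have hint' : Integrable (fun z : R3 × R3 => ‖z.1‖⁻¹ * f z)
      ((volume : Measure R3).prod volume) := by
    rw [← Measure.volume_eq_prod]; exact hint
  have hpi := Real.pi_pos
  have hrho : ∀ᵐ x : R3, 0 ≤ rho f x := by
    have h := hf.nonneg
    rw [Measure.volume_eq_prod] at h
    filter_upwards [Measure.ae_ae_of_ae_prod h] with x hx
    exact integral_nonneg_of_ae hx
  have e : (fun x : R3 => ‖x‖⁻¹ * rho f x) = fun x : R3 => ∫ v : R3, ‖x‖⁻¹ * f (x, v) := by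
    ext x
    rw [integral_const_mul, rho]
  have hI2 : Integrable (fun x : R3 => ‖x‖⁻¹ * rho f x) := by
    rw [e]
    exact hint'.integral_prod_left
  have hinv : ∫ x : R3, ‖x‖⁻¹ * rho f x = invMoment f := by
    rw [invMoment, Measure.volume_eq_prod, integral_prod _ hint', e]
  have hfun : (fun x : R3 => 1 / (8 * Real.pi) * (‖gradU f x‖ ^ 2 + 8 * Real.pi * Mc / ‖x‖ * rho f x))
      = fun x => 1 / (8 * Real.pi) * ‖gradU f x‖ ^ 2 + Mc * (‖x‖⁻¹ * rho f x) := by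
    ext x
    rw [mul_add]
    congr 1
    field_simp
  have hI1 := (hf.integrable_gradU_sq hL₀).const_mul (1 / (8 * Real.pi))
  have hI12 : Integrable (fun x : R3 =>
      1 / (8 * Real.pi) * ‖gradU f x‖ ^ 2 + Mc * (‖x‖⁻¹ * rho f x)) := hI1.add (hI2.const_mul Mc)
  simp only [negEPot]
  rw [fieldSq, ← hinv, ← integral_const_mul, ← integral_const_mul,
    ← integral_add hI1 (hI2.const_mul _),
    ofReal_integral_eq_lintegral_ofReal hI12]
  · exact lintegral_congr fun x => congrArg _ (congrFun hfun x)
  · filter_upwards [hrho] with x hx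
    simp only [Pi.zero_apply]
    positivity

theorem fieldSq_nonneg (f : Phase → ℝ) : 0 ≤ fieldSq f :=
  integral_nonneg fun x => by positivity

theorem energyCasimir_eq (hf : Admissible k l L₀ M f) (hk : 0 < k) (hL₀ : 0 < L₀) {Mc : ℝ}
    (hMc : 0 < Mc) : energyCasimir k l L₀ Mc f = (energyReal k l L₀ Mc f : EReal) := by
  have h1 := hf.kin_nonneg
  have h2 := cas_nonneg (k := k) (l := l) (L₀ := L₀) hf.nonneg
  have h3 := hf.invMoment_nonneg
  have h4 := fieldSq_nonneg f
  have hpi := Real.pi_pos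
  rw [energyCasimir, hf.eKin_eq, casimir_eq_ofReal hk hf.integrable.1 (hf.memLp hk) hf.nonneg,
    hf.negEPot_eq hL₀ hMc, ← ENNReal.ofReal_add (by positivity) h2, EReal.coe_ennreal_ofReal,
    EReal.coe_ennreal_ofReal, max_eq_left (by positivity), max_eq_left (by positivity), energyReal,
    EReal.coe_sub]

end Admissible

/-! ### Coercivity -/

/-- The energy-Casimir functional is coercive. -/
theorem exists_energyReal_ge (k l M : ℝ) {L₀ Mc : ℝ} (hL₀ : 0 < L₀) (hMc : 0 < Mc) :
    ∃ B : ℝ, ∀ f, Admissible k l L₀ M f →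
      1 / 4 * kin f + cas k l L₀ f - B ≤ energyReal k l L₀ Mc f := by
  have hpi := Real.pi_pos
  set κ := 1 / (8 * Real.pi) * (16 * max 1 M ^ 2 * (∫ x : R3, (1 + ‖x‖) ^ (-4 : ℝ))) with hκ
  have hκ0 : 0 ≤ κ := by
    have : 0 ≤ ∫ x : R3, (1 + ‖x‖) ^ (-4 : ℝ) := integral_nonneg fun x => by positivity
    positivity
  -- With this `δ` the `1/|x|` term uses up `kin / 8`. The field term uses another `kin / 8` by
  -- completing the square, so `kin / 4` remains of `kin / 2`.
  set δ := L₀ / (8 * Mc) with hδ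
  have hδ0 : 0 < δ := by positivity
  refine ⟨Mc * (1 / (4 * δ) * M) + 1 / 8 + 2 * κ ^ 2 / L₀ + L₀ / 8, fun f hf => ?_⟩
  have h1 := hf.kin_nonneg
  have h2 := hf.invMoment_le hL₀ hδ0
  have h3 := hf.fieldSq_le hL₀
  have h4 : 1 / (8 * Real.pi) * fieldSq f ≤ κ * √(kin f / L₀ + 1) := by
    calc _ ≤ 1 / (8 * Real.pi) *
          (16 * max 1 M ^ 2 * (∫ x : R3, (1 + ‖x‖) ^ (-4 : ℝ)) * √(kin f / L₀ + 1)) := by gcongr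
      _ = _ := by rw [hκ]; ring
  set s := √(kin f / L₀ + 1) with hs
  have hs2 : L₀ * s ^ 2 = kin f + L₀ := by
    rw [hs, Real.sq_sqrt (by positivity)]
    field_simp
  have h5 : κ * s ≤ L₀ / 8 * s ^ 2 + 2 * κ ^ 2 / L₀ := by
    have e : L₀ / 8 * s ^ 2 + 2 * κ ^ 2 / L₀ - κ * s = (L₀ * s - 4 * κ) ^ 2 / (8 * L₀) := by
      field_simp
      ring
    have : 0 ≤ (L₀ * s - 4 * κ) ^ 2 / (8 * L₀) := by positivity
    linarith
  have h6 : Mc * invMoment f ≤ 1 / 8 * kin f + Mc * (1 / (4 * δ) * M) := by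
    have := mul_le_mul_of_nonneg_left h2 hMc.le
    have e : Mc * (δ / L₀ * kin f + 1 / (4 * δ) * M) = 1 / 8 * kin f + Mc * (1 / (4 * δ) * M) := by
      rw [mul_add, hδ]
      congr 1
      field_simp
    linarith
  simp only [energyReal]
  linarith

/-! ### Midpoints of admissible functions -/

theorem massIn_rho_add {f g : Phase → ℝ} (hf : Integrable f) (hg : Integrable g) :
    massIn (rho fun z => f z + g z) = massIn (rho f) + massIn (rho g) := by
  ext r
  have hfg : Integrable fun z => f z + g z := hf.add hg
  rw [massIn_rho hfg, Pi.add_apply, massIn_rho hf, massIn_rho hg,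
    integral_add hf.integrableOn hg.integrableOn]

theorem massIn_rho_const_mul (c : ℝ) (f : Phase → ℝ) :
    massIn (rho fun z => c * f z) = c • massIn (rho f) := by
  ext r
  simp only [massIn, rho, integral_const_mul, Pi.smul_apply, smul_eq_mul]

theorem SphSymm.add {f g : Phase → ℝ} (hf : SphSymm f) (hg : SphSymm g) :
    SphSymm fun z => f z + g z := fun A => by
  filter_upwards [hf A, hg A] with z h1 h2
  rw [h1, h2]

theorem SphSymm.const_mul {f : Phase → ℝ} (hf : SphSymm f) (c : ℝ) :
    SphSymm fun z => c * f z := fun A => by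
  filter_upwards [hf A] with z h1
  rw [h1]

theorem gradU_midpoint {f g : Phase → ℝ} (hf : Integrable f) (hg : Integrable g) :
    gradU (fun z => 1 / 2 * (f z + g z)) = (1 / 2 : ℝ) • (gradU f + gradU g) := by
  rw [gradU_eq_radialField, massIn_rho_const_mul, massIn_rho_add hf hg, radialField_smul,
    radialField_add]
  rfl

namespace Admissible

variable {k l L₀ M Mc : ℝ} {f g : Phase → ℝ}

theorem midpoint (hf : Admissible k l L₀ M f) (hg : Admissible k l L₀ M g) (hk : 0 < k) :
    Admissible k l L₀ M fun z => 1 / 2 * (f z + g z) := by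
  refine Admissible.of_integrable hk ((hf.integrable.add hg.integrable).const_mul _) ?_
    ((hf.sphSymm.add hg.sphSymm).const_mul _) ?_ ?_
    (((hf.memLp hk).add (hg.memLp hk)).const_mul _) ?_
  · filter_upwards [hf.nonneg, hg.nonneg] with z h1 h2
    positivity
  · rw [integral_const_mul, integral_add hf.integrable hg.integrable, hf.mass, hg.mass]
    ring
  · refine ((hf.integrable_kin.add hg.integrable_kin).const_mul (1 / 2)).congr
      (Eventually.of_forall fun z => ?_)
    simp only [Pi.add_apply]
    ring
  · filter_upwards [hf.vanish, hg.vanish] with z h1 h2 h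
    rw [h1 h, h2 h]
    simp

theorem kin_midpoint (hf : Admissible k l L₀ M f) (hg : Admissible k l L₀ M g) :
    kin (fun z => 1 / 2 * (f z + g z)) = (kin f + kin g) / 2 := by
  simp only [kin]
  rw [← integral_add hf.integrable_kin hg.integrable_kin, ← integral_div]
  congr 1
  ext z
  ring

theorem invMoment_midpoint (hf : Admissible k l L₀ M f) (hg : Admissible k l L₀ M g)
    (hL₀ : 0 < L₀) :
    invMoment (fun z => 1 / 2 * (f z + g z)) = (invMoment f + invMoment g) / 2 := by
  simp only [invMoment]
  rw [← integral_add (hf.integrable_inv hL₀) (hg.integrable_inv hL₀), ← integral_div]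
  congr 1
  ext z
  ring

theorem integrable_gradU_sub_sq (hf : Admissible k l L₀ M f) (hg : Admissible k l L₀ M g)
    (hL₀ : 0 < L₀) : Integrable fun x : R3 => ‖gradU f x - gradU g x‖ ^ 2 := by
  have h := (hf.memLp_gradU hL₀).sub (hg.memLp_gradU hL₀)
  exact (memLp_two_iff_integrable_sq_norm h.1).1 h

theorem fieldSq_midpoint (hf : Admissible k l L₀ M f) (hg : Admissible k l L₀ M g)
    (hL₀ : 0 < L₀) :
    fieldSq (fun z => 1 / 2 * (f z + g z)) =
      (fieldSq f + fieldSq g) / 2 - 1 / 4 * ∫ x : R3, ‖gradU f x - gradU g x‖ ^ 2 := by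
  have h1 := hf.integrable_gradU_sq hL₀
  have h2 := hg.integrable_gradU_sq hL₀
  have h12 : Integrable fun x : R3 => (‖gradU f x‖ ^ 2 + ‖gradU g x‖ ^ 2) / 2 :=
    (h1.add h2).div_const 2
  simp only [fieldSq]
  rw [← integral_add h1 h2, ← integral_div, ← integral_const_mul,
    ← integral_sub h12 ((hf.integrable_gradU_sub_sq hg hL₀).const_mul _)]
  congr 1
  ext x
  rw [gradU_midpoint hf.integrable hg.integrable, Pi.smul_apply, norm_smul, Pi.add_apply]
  have h := parallelogram_law_with_norm ℝ (gradU f x) (gradU g x)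
  norm_num
  linarith

/-- The linear terms drop out, and the parallelogram law gives the last term with `1/(32π) = (1/4)
(1/(8π))`. Since the field enters the energy with a minus sign, its difference is the only
obstruction to convexity. -/
theorem energyReal_midpoint (hf : Admissible k l L₀ M f) (hg : Admissible k l L₀ M g)
    (hL₀ : 0 < L₀) :
    energyReal k l L₀ Mc (fun z => 1 / 2 * (f z + g z)) =
      (energyReal k l L₀ Mc f + energyReal k l L₀ Mc g) / 2
      - ((cas k l L₀ f + cas k l L₀ g) / 2 - cas k l L₀ fun z => 1 / 2 * (f z + g z))
      + 1 / (32 * Real.pi) * ∫ x : R3, ‖gradU f x - gradU g x‖ ^ 2 := by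
  have hpi := Real.pi_ne_zero
  simp only [energyReal]
  rw [hf.kin_midpoint hg, hf.invMoment_midpoint hg hL₀, hf.fieldSq_midpoint hg hL₀]
  field_simp
  ring

end Admissible

/-! ### Compactness of minimizing sequences -/

section Sequences

variable {k l L₀ M Mc : ℝ} {f : ℕ → Phase → ℝ}

theorem abs_sub_le_of_nonneg_le {a b c : ℝ} (ha : 0 ≤ a) (hb : 0 ≤ b) (ha' : a ≤ c)
    (hb' : b ≤ c) : |a - b| ≤ c := by
  rw [abs_le]
  constructor <;> linarith

/-- Helly's theorem applies to the enclosed masses. Their pointwise limit need not yet be the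
enclosed mass of any function, so dominated convergence is applied to differences over pairs of
indices, which tend to 0 off a countable set of radii. -/
theorem exists_subseq_gradU_cauchy (hL₀ : 0 < L₀) (hf : ∀ j, Admissible k l L₀ M (f j)) {K : ℝ}
    (hK : ∀ j, kin (f j) ≤ K) :
    ∃ s : ℕ → ℕ, StrictMono s ∧
      Tendsto (fun n : ℕ × ℕ => ∫ x : R3, ‖gradU (f (s n.1)) x - gradU (f (s n.2)) x‖ ^ 2)
        (atTop ×ˢ atTop) (𝓝 0) := by
  obtain ⟨s, F, S, hs, hS, hlim⟩ := exists_subseq_tendsto_of_monotone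
    (m := fun j => massIn (rho (f j))) (fun j => (hf j).massIn_mono) (a := 0) (b := M)
    fun j r => ⟨(hf j).massIn_nonneg r, (hf j).massIn_le r⟩
  refine ⟨s, hs, ?_⟩
  have hK0 : 0 ≤ K := (hf 0).kin_nonneg.trans (hK 0)
  have hA : ∀ j r, massIn (rho (f j)) r ≤ (K / L₀ + 1) * r ^ 2 := by
    intro j r
    have h1 : kin (f j) / L₀ ≤ K / L₀ := by gcongr; exact hK j
    exact (le_abs_self _).trans ((hf j).abs_massIn_le_sq hL₀ (by linarith) r)
  have h := tendsto_integral_norm_radialField_sq (u := (atTop ×ˢ atTop : Filter (ℕ × ℕ)))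
    (m := fun n => massIn (rho (f (s n.1))) - massIn (rho (f (s n.2)))) (m' := 0)
    (fun n => (hf _).massIn_mono.measurable.sub (hf _).massIn_mono.measurable)
    (A := K / L₀ + 1) (M := M) (by positivity)
    (fun n r _ => abs_sub_le_of_nonneg_le ((hf _).massIn_nonneg r) ((hf _).massIn_nonneg r)
      ((hf _).massIn_le r) ((hf _).massIn_le r))
    (fun n r _ => abs_sub_le_of_nonneg_le ((hf _).massIn_nonneg r) ((hf _).massIn_nonneg r)
      (hA _ r) (hA _ r)) hS (fun r hr => by
        have := ((hlim r hr).comp tendsto_fst).sub ((hlim r hr).comp (tendsto_snd (f := atTop)))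
        simpa using this)
  simp only [← radialField_sub, ← gradU_eq_radialField, radialField_zero] at h
  simpa using h

theorem tendsto_fieldSq (hL₀ : 0 < L₀) (hf : ∀ j, Admissible k l L₀ M (f j)) {K : ℝ}
    (hK : ∀ j, kin (f j) ≤ K) {f₀ : Phase → ℝ}
    (hlim : ∀ r, Tendsto (fun j => massIn (rho (f j)) r) atTop (𝓝 (massIn (rho f₀) r))) :
    Tendsto (fun j => fieldSq (f j)) atTop (𝓝 (fieldSq f₀)) := by
  have hK0 : 0 ≤ K := (hf 0).kin_nonneg.trans (hK 0)
  refine tendsto_integral_norm_radialField_sq (fun j => (hf j).massIn_mono.measurable)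
    (A := K / L₀ + 1) (M := M) (by positivity) (fun j r _ => (hf j).abs_massIn_le r)
    (fun j r _ => ?_) Set.countable_empty (fun r _ => hlim r)
  have h1 : kin (f j) / L₀ ≤ K / L₀ := by gcongr; exact hK j
  exact (hf j).abs_massIn_le_sq hL₀ (by linarith) r

theorem tendsto_eLpNorm_gradU_sub (hL₀ : 0 < L₀) (hf : ∀ j, Admissible k l L₀ M (f j)) {K : ℝ}
    (hK : ∀ j, kin (f j) ≤ K) {f₀ : Phase → ℝ} (hf₀ : Admissible k l L₀ M f₀)
    (hlim : ∀ r, Tendsto (fun j => massIn (rho (f j)) r) atTop (𝓝 (massIn (rho f₀) r))) :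
    Tendsto (fun j => eLpNorm (gradU (f j) - gradU f₀) 2 volume) atTop (𝓝 0) := by
  have hK0 : 0 ≤ K := (hf 0).kin_nonneg.trans (hK 0)
  set A := max K (kin f₀) / L₀ + 1 with hAdef
  have hA0 : 0 < A := by positivity
  have hA : ∀ g, Admissible k l L₀ M g → kin g ≤ max K (kin f₀) → ∀ r,
      massIn (rho g) r ≤ A * r ^ 2 := by
    intro g hg hgk r
    have h1 : kin g / L₀ ≤ max K (kin f₀) / L₀ := by gcongr
    exact (le_abs_self _).trans (hg.abs_massIn_le_sq hL₀ (by linarith) r)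
  have h := tendsto_integral_norm_radialField_sq
    (m := fun j => massIn (rho (f j)) - massIn (rho f₀)) (m' := 0) (u := atTop)
    (fun n => (hf _).massIn_mono.measurable.sub hf₀.massIn_mono.measurable)
    (M := M) hA0
    (fun n r _ => abs_sub_le_of_nonneg_le ((hf _).massIn_nonneg r) (hf₀.massIn_nonneg r)
      ((hf _).massIn_le r) (hf₀.massIn_le r))
    (fun n r _ => abs_sub_le_of_nonneg_le ((hf _).massIn_nonneg r) (hf₀.massIn_nonneg r)
      (hA _ (hf n) ((hK n).trans (le_max_left _ _)) r) (hA _ hf₀ (le_max_right _ _) r))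
    Set.countable_empty (fun r _ => by simpa using (hlim r).sub_const (massIn (rho f₀) r))
  simp only [← radialField_sub, ← gradU_eq_radialField, radialField_zero] at h
  have h2 := ENNReal.tendsto_ofReal (Real.continuous_sqrt.continuousAt.tendsto.comp h)
  refine Tendsto.congr (fun j => ?_) (by simpa using h2)
  rw [eLpNorm_two_eq_ofReal_sqrt (((hf j).memLp_gradU hL₀).sub (hf₀.memLp_gradU hL₀))]
  rfl

theorem exists_hInf_eq_coe (hk : 0 < k) (hL₀ : 0 < L₀) (hMc : 0 < Mc) {g : Phase → ℝ}
    (hg : Admissible k l L₀ M g) :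
    ∃ h : ℝ, hInf k l L₀ Mc M = (h : EReal) ∧
      ∀ f, Admissible k l L₀ M f → h ≤ energyReal k l L₀ Mc f := by
  obtain ⟨B, hB⟩ := exists_energyReal_ge k l M hL₀ hMc
  have hle : ∀ f, Admissible k l L₀ M f → hInf k l L₀ Mc M ≤ (energyReal k l L₀ Mc f : EReal) :=
    fun f hf => sInf_le ⟨f, hf, hf.energyCasimir_eq hk hL₀ hMc⟩
  have hge : ((-B : ℝ) : EReal) ≤ hInf k l L₀ Mc M := by
    refine le_sInf ?_
    rintro _ ⟨f, hf, rfl⟩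
    rw [Admissible.energyCasimir_eq hf hk hL₀ hMc, EReal.coe_le_coe_iff]
    have h1 := hB f hf
    have h2 := hf.kin_nonneg
    have h3 := cas_nonneg (k := k) (l := l) (L₀ := L₀) hf.nonneg
    linarith
  have hcoe : ((hInf k l L₀ Mc M).toReal : EReal) = hInf k l L₀ Mc M :=
    EReal.coe_toReal (ne_top_of_le_ne_top (EReal.coe_ne_top _) (hle g hg))
      (ne_bot_of_le_ne_bot (EReal.coe_ne_bot _) hge)
  refine ⟨_, hcoe.symm, fun f hf => ?_⟩
  rw [← EReal.coe_le_coe_iff, hcoe]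
  exact hle f hf

/-- A minimizing sequence has a subsequence that converges strongly in the weighted `L^p`. -/
theorem exists_subseq_tendsto_Lp (hk : 0 < k) (hL₀ : 0 < L₀)
    (hf : ∀ j, Admissible k l L₀ M (f j)) {h K : ℝ}
    (hh : ∀ g, Admissible k l L₀ M g → h ≤ energyReal k l L₀ Mc g)
    (hlim : Tendsto (fun j => energyReal k l L₀ Mc (f j)) atTop (𝓝 h))
    (hK : ∀ j, kin (f j) ≤ K) (hC : ∀ j, cas k l L₀ (f j) ≤ K) :
    ∃ (s : ℕ → ℕ) (f₀ : Phase → ℝ), StrictMono s ∧ MemLp f₀ (expo k) (weightedMeasure k l L₀) ∧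
      Tendsto (fun j => eLpNorm (f (s j) - f₀) (expo k) (weightedMeasure k l L₀)) atTop (𝓝 0) := by
  obtain ⟨s, hs, hcau⟩ := exists_subseq_gradU_cauchy hL₀ hf hK
  have hlim' := hlim.comp hs.tendsto_atTop
  have hdef : ∀ ε > 0, ∃ N, ∀ i ≥ N, ∀ j ≥ N,
      (∫ z, f (s i) z ^ (expo k).toReal ∂weightedMeasure k l L₀
        + ∫ z, f (s j) z ^ (expo k).toReal ∂weightedMeasure k l L₀) / 2
        - ∫ z, ((f (s i) z + f (s j) z) / 2) ^ (expo k).toReal ∂weightedMeasure k l L₀ ≤ ε := by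
    intro ε hε
    have ht : Tendsto (fun n : ℕ × ℕ =>
        (energyReal k l L₀ Mc (f (s n.1)) + energyReal k l L₀ Mc (f (s n.2))) / 2 - h
        + 1 / (32 * Real.pi) * ∫ x : R3, ‖gradU (f (s n.1)) x - gradU (f (s n.2)) x‖ ^ 2)
        (atTop ×ˢ atTop) (𝓝 ((h + h) / 2 - h + 1 / (32 * Real.pi) * 0)) :=
      ((((hlim'.comp tendsto_fst).add (hlim'.comp (tendsto_snd (f := atTop)))).div_const 2).sub_const
        h).add (hcau.const_mul _)
    rw [show (h + h) / 2 - h + 1 / (32 * Real.pi) * 0 = 0 by ring, prod_atTop_atTop_eq] at ht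
    obtain ⟨⟨N₁, N₂⟩, hN⟩ := eventually_atTop.1 (ht.eventually_le_const hε)
    refine ⟨max N₁ N₂, fun i hi j hj => ?_⟩
    have h1 := hN (i, j) ⟨le_of_max_le_left hi, le_of_max_le_right hj⟩
    -- The midpoint is a competitor, so its energy is at least `h`; this bounds the Casimir defect
    -- by the quantity made small in `h1`.
    have h2 := hh _ ((hf (s i)).midpoint (hf (s j)) hk)
    rw [(hf (s i)).energyReal_midpoint (hf (s j)) hL₀] at h2
    have e : ∫ z, ((f (s i) z + f (s j) z) / 2) ^ (expo k).toReal ∂weightedMeasure k l L₀ =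
        cas k l L₀ fun z => 1 / 2 * (f (s i) z + f (s j) z) := by
      simp only [cas]
      congr 1
      ext z
      congr 1
      ring
    rw [e]
    simp only [cas] at h1 h2 ⊢
    linarith
  obtain ⟨f₀, hf₀, hconv⟩ := exists_tendsto_eLpNorm_of_midpoint (q := expo k)
    (μ := weightedMeasure k l L₀) (f := fun j => f (s j)) (by
      rw [toReal_expo hk]
      have : 0 < 1 / k := by positivity
      linarith) expo_ne_top
    (fun j => (hf (s j)).memLp hk) (fun j => (hf (s j)).ae_weighted_nonneg) (B := K)
    (fun j => hC (s j)) hdef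
  exact ⟨s, f₀, hs, hf₀, hconv⟩

end Sequences

/-! ### Passage to the limit -/

/-- **Fatou's lemma** for Bochner integrals of nonnegative functions. -/
theorem integrable_and_integral_le_of_tendsto_ae {α : Type*} [MeasurableSpace α] {μ : Measure α}
    {f : ℕ → α → ℝ} {g : α → ℝ} (hf : ∀ n, Integrable (f n) μ) (hf0 : ∀ n, ∀ᵐ x ∂μ, 0 ≤ f n x)
    (hg : AEStronglyMeasurable g μ)
    (hlim : ∀ᵐ x ∂μ, Tendsto (fun n => f n x) atTop (𝓝 (g x))) {K : ℝ}
    (hK : ∀ᶠ n in atTop, ∫ x, f n x ∂μ ≤ K) : Integrable g μ ∧ ∫ x, g x ∂μ ≤ K := by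
  have hg0 : ∀ᵐ x ∂μ, 0 ≤ g x := by
    filter_upwards [hlim, ae_all_iff.2 hf0] with x h1 h2 using ge_of_tendsto' h1 h2
  have hK0 : 0 ≤ K := by
    obtain ⟨n, hn⟩ := hK.exists
    exact (integral_nonneg_of_ae (hf0 n)).trans hn
  have hle : ∫⁻ x, ENNReal.ofReal (g x) ∂μ ≤ ENNReal.ofReal K := by
    calc ∫⁻ x, ENNReal.ofReal (g x) ∂μ
        = ∫⁻ x, liminf (fun n => ENNReal.ofReal (f n x)) atTop ∂μ := by
          refine lintegral_congr_ae ?_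
          filter_upwards [hlim] with x hx using (ENNReal.tendsto_ofReal hx).liminf_eq.symm
      _ ≤ liminf (fun n => ∫⁻ x, ENNReal.ofReal (f n x) ∂μ) atTop :=
          lintegral_liminf_le' fun n => (hf n).1.aemeasurable.ennreal_ofReal
      _ ≤ ENNReal.ofReal K := by
          refine liminf_le_of_frequently_le' (Eventually.frequently ?_)
          filter_upwards [hK] with n hn
          rw [← ofReal_integral_eq_lintegral_ofReal (hf n) (hf0 n)]
          exact ENNReal.ofReal_le_ofReal hn
  have hint : Integrable g μ :=
    ⟨hg, (hasFiniteIntegral_iff_ofReal hg0).2 (hle.trans_lt ENNReal.ofReal_lt_top)⟩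
  refine ⟨hint, ?_⟩
  rwa [← ofReal_integral_eq_lintegral_ofReal hint hg0, ENNReal.ofReal_le_ofReal_iff hK0] at hle

/-- The set of points with `|x| ≤ R` and `|v| ≤ R`. -/
def phaseBox (R : ℝ) : Set Phase := Metric.closedBall 0 R ×ˢ Metric.closedBall 0 R

theorem measurableSet_phaseBox (R : ℝ) : MeasurableSet (phaseBox R) :=
  measurableSet_closedBall.prod measurableSet_closedBall

theorem mem_phaseBox {R : ℝ} {z : Phase} : z ∈ phaseBox R ↔ ‖z.1‖ ≤ R ∧ ‖z.2‖ ≤ R := by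
  simp [phaseBox]

theorem volume_phaseBox_lt_top (R : ℝ) : volume (phaseBox R) < ∞ := by
  rw [phaseBox, Measure.volume_eq_prod, Measure.prod_prod]
  exact ENNReal.mul_lt_top measure_closedBall_lt_top measure_closedBall_lt_top

/-- On the box `L - L₀ ≤ R⁴`, and the exponent of the weight is negative, so the weight is bounded
below there. Weighted convergence thus controls convergence in `L¹` of bounded sets. -/
theorem exists_restrict_phaseBox_le {k l L₀ : ℝ} (hk : 0 < k) (hl : 0 < l) (hL₀ : 0 < L₀) {R : ℝ}
    (hR : 0 < R) : ∃ c : ℝ≥0∞, c ≠ ∞ ∧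
      (volume : Measure Phase).restrict (phaseBox R) ≤ c • weightedMeasure k l L₀ := by
  set w : ℝ≥0∞ := ENNReal.ofReal (R ^ 2 * R ^ 2) ^ (-(l / k)) with hw
  have hlk : 0 < l / k := by positivity
  have hR4 : ENNReal.ofReal (R ^ 2 * R ^ 2) ≠ 0 := by
    rw [Ne, ENNReal.ofReal_eq_zero, not_le]
    positivity
  have hw0 : w ≠ 0 := by
    simp [hw, ENNReal.rpow_eq_zero_iff, hlk.le, hlk]
  have hwt : w ≠ ∞ := ENNReal.rpow_ne_top_of_ne_zero hR4 ENNReal.ofReal_ne_top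
  have hle : ∀ z ∈ phaseBox R, w ≤ weight k l L₀ z := by
    intro z hz
    rw [mem_phaseBox] at hz
    rw [hw, weight, ENNReal.rpow_neg, ENNReal.rpow_neg, ENNReal.inv_le_inv]
    refine ENNReal.rpow_le_rpow (ENNReal.ofReal_le_ofReal ?_) hlk.le
    have h1 := angMomSq_le z
    have h2 : ‖z.1‖ ^ 2 * ‖z.2‖ ^ 2 ≤ R ^ 2 * R ^ 2 := by
      gcongr
      · exact hz.1
      · exact hz.2
    linarith
  refine ⟨w⁻¹, ENNReal.inv_ne_top.2 hw0, Measure.le_iff.2 fun s hs => ?_⟩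
  have hsm := hs.inter (measurableSet_phaseBox R)
  rw [Measure.restrict_apply hs, Measure.smul_apply, smul_eq_mul, ← ENNReal.div_eq_inv_mul,
    ENNReal.le_div_iff_mul_le (Or.inl hw0) (Or.inl hwt), mul_comm]
  calc w * volume (s ∩ phaseBox R) = ∫⁻ _ in s ∩ phaseBox R, w := by
        rw [setLIntegral_const]
    _ ≤ ∫⁻ z in s ∩ phaseBox R, weight k l L₀ z :=
        setLIntegral_mono measurable_weight fun z hz => hle z hz.2
    _ = weightedMeasure k l L₀ (s ∩ phaseBox R) := by
        rw [weightedMeasure, withDensity_apply _ hsm]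
    _ ≤ weightedMeasure k l L₀ s := measure_mono Set.inter_subset_left

theorem one_le_expo {k : ℝ} : 1 ≤ expo k := le_self_add

section Limit

variable {k l L₀ M : ℝ} {f : ℕ → Phase → ℝ} {f₀ : Phase → ℝ}

theorem tendsto_setIntegral_phaseBox (hk : 0 < k) (hl : 0 < l) (hL₀ : 0 < L₀)
    (hf : ∀ j, Integrable (f j)) (hf₀ : Integrable f₀)
    (hlim : Tendsto (fun j => eLpNorm (f j - f₀) (expo k) (weightedMeasure k l L₀)) atTop (𝓝 0))
    {R : ℝ} (hR : 0 < R) :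
    Tendsto (fun j => ∫ z in phaseBox R, |f j z - f₀ z|) atTop (𝓝 0) := by
  obtain ⟨c, hc, hle⟩ := exists_restrict_phaseBox_le (l := l) hk hl hL₀ hR
  have hE : ∀ j, eLpNorm (f j - f₀) 1 (volume.restrict (phaseBox R)) ≤
      (c ^ (1 / (expo k).toReal) * volume (phaseBox R) ^ (1 / (1 : ℝ≥0∞).toReal -
        1 / (expo k).toReal)) * eLpNorm (f j - f₀) (expo k) (weightedMeasure k l L₀) := by
    intro j
    have h1 := eLpNorm_le_eLpNorm_mul_rpow_measure_univ (one_le_expo (k := k))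
      (μ := volume.restrict (phaseBox R)) (f := f j - f₀) ((hf j).sub hf₀).1.restrict
    have h2 : eLpNorm (f j - f₀) (expo k) (volume.restrict (phaseBox R)) ≤
        c ^ (1 / (expo k).toReal) * eLpNorm (f j - f₀) (expo k) (weightedMeasure k l L₀) := by
      refine (eLpNorm_mono_measure _ hle).trans_eq ?_
      rw [eLpNorm_smul_measure_of_ne_top expo_ne_top]
      simp
    rw [Measure.restrict_apply_univ] at h1
    refine h1.trans ?_
    rw [mul_right_comm]
    gcongr
  have hvol := (volume_phaseBox_lt_top R).ne
  have hexp : 0 ≤ 1 / (1 : ℝ≥0∞).toReal - 1 / (expo k).toReal := by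
    have h1 : 1 ≤ (expo k).toReal := by
      rw [toReal_expo hk]
      have : 0 < 1 / k := by positivity
      linarith
    simp only [ENNReal.toReal_one, div_one, sub_nonneg]
    rw [div_le_one (by linarith)]
    exact h1
  have hconst : c ^ (1 / (expo k).toReal) * volume (phaseBox R) ^ (1 / (1 : ℝ≥0∞).toReal -
      1 / (expo k).toReal) ≠ ∞ :=
    ENNReal.mul_ne_top (ENNReal.rpow_ne_top_of_nonneg (by positivity) hc)
      (ENNReal.rpow_ne_top_of_nonneg hexp hvol)
  have ht : Tendsto (fun j => eLpNorm (f j - f₀) 1 (volume.restrict (phaseBox R))) atTop (𝓝 0) := by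
    refine tendsto_of_tendsto_of_tendsto_of_le_of_le tendsto_const_nhds ?_ (fun _ => zero_le)
      hE
    simpa using ENNReal.Tendsto.const_mul hlim (Or.inr hconst)
  have ht2 := (ENNReal.tendsto_toReal ENNReal.zero_ne_top).comp ht
  refine Tendsto.congr (fun j => ?_) (by simpa using ht2)
  rw [Function.comp_apply, eLpNorm_one_eq_lintegral_enorm,
    ← integral_norm_eq_lintegral_enorm ((hf j).sub hf₀).1.restrict]
  rfl

theorem integrable_mul_of_le {Φ : Phase → ℝ} (hΦ : Measurable Φ) (hΦ0 : ∀ z, 0 ≤ Φ z)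
    {M : ℝ} {g : Phase → ℝ} (hg : Admissible k l L₀ M g) {a K : ℝ} {S : Set Phase}
    (hK : 0 ≤ K) (hle : ∀ z, L₀ ≤ angMomSq z → Φ z ≤ a * (1 + ‖z.2‖ ^ 2) + S.indicator (fun _ => K) z) :
    Integrable fun z => Φ z * g z := by
  have hI : Integrable fun z : Phase => a * (g z + ‖z.2‖ ^ 2 * g z) + K * g z :=
    ((hg.integrable.add hg.integrable_kin).const_mul a).add (hg.integrable.const_mul K)
  refine hI.mono' (hΦ.aestronglyMeasurable.mul hg.integrable.1) ?_
  filter_upwards [hg.nonneg, hg.ae_le_angMomSq] with z h0 h1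
  rw [Real.norm_of_nonneg (mul_nonneg (hΦ0 z) h0)]
  rcases eq_or_ne (g z) 0 with h | h
  · simp [h]
  · have h2 := hle z (h1 h)
    have h3 : S.indicator (fun _ => K) z ≤ K := Set.indicator_le_self' (fun _ _ => hK) z
    calc Φ z * g z ≤ (a * (1 + ‖z.2‖ ^ 2) + K) * g z := by gcongr; linarith
      _ = _ := by ring

/-- Convergence of moments against weights that are small compared to `1 + |v|²` outside of
bounded sets. -/
theorem tendsto_moment (hk : 0 < k) (hl : 0 < l) (hL₀ : 0 < L₀)
    (hf : ∀ j, Admissible k l L₀ M (f j)) {K : ℝ} (hK : ∀ j, kin (f j) ≤ K) {M₀ : ℝ}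
    (hf₀ : Admissible k l L₀ M₀ f₀)
    (hlim : Tendsto (fun j => eLpNorm (f j - f₀) (expo k) (weightedMeasure k l L₀)) atTop (𝓝 0))
    {Φ : Phase → ℝ} (hΦ : Measurable Φ) (hΦ0 : ∀ z, 0 ≤ Φ z)
    (hdec : ∀ ε > 0, ∃ R > 0, ∃ C ≥ 0, ∀ z, L₀ ≤ angMomSq z →
      Φ z ≤ ε * (1 + ‖z.2‖ ^ 2) + (phaseBox R).indicator (fun _ => C) z) :
    Tendsto (fun j => ∫ z, Φ z * f j z) atTop (𝓝 (∫ z, Φ z * f₀ z)) := by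
  obtain ⟨R₁, -, C₁, hC₁, hle₁⟩ := hdec 1 one_pos
  have hI : ∀ j, Integrable fun z => Φ z * f j z := fun j =>
    integrable_mul_of_le hΦ hΦ0 (hf j) hC₁ hle₁
  have hI₀ : Integrable fun z => Φ z * f₀ z := integrable_mul_of_le hΦ hΦ0 hf₀ hC₁ hle₁
  have hK0 : 0 ≤ K := (hf 0).kin_nonneg.trans (hK 0)
  have hM0 := (hf 0).mass_nonneg
  have hM₀ := hf₀.mass_nonneg
  have hk₀ := hf₀.kin_nonneg
  rw [Metric.tendsto_atTop]
  intro ε hε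
  -- `T` bounds the total of `(1 + |v|²) (f j + f₀)`, so the tail costs at most `ε / 2`; the box
  -- then costs at most `ε / 4`.
  set T := M + M₀ + (K + kin f₀) + 1 with hT
  have hT0 : 0 < T := by positivity
  obtain ⟨R, hR, C, hC, hle⟩ := hdec (ε / (2 * T)) (by positivity)
  have hbox := tendsto_setIntegral_phaseBox hk hl hL₀ (fun j => (hf j).integrable) hf₀.integrable
    hlim hR
  obtain ⟨N, hN⟩ := Metric.tendsto_atTop.1 hbox (ε / (4 * (C + 1))) (by positivity)
  refine ⟨N, fun j hj => ?_⟩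
  have hNj := hN j hj
  rw [Real.dist_eq, sub_zero] at hNj
  have hNj' := (le_abs_self _).trans hNj.le
  have hbound : ∀ᵐ z : Phase, ‖Φ z * f j z - Φ z * f₀ z‖ ≤
      ε / (2 * T) * ((f j z + f₀ z) + (‖z.2‖ ^ 2 * f j z + ‖z.2‖ ^ 2 * f₀ z))
        + C * (phaseBox R).indicator (fun z => |f j z - f₀ z|) z := by
    filter_upwards [(hf j).nonneg, hf₀.nonneg, (hf j).ae_le_angMomSq, hf₀.ae_le_angMomSq]
      with z a0 b0 a1 b1
    have hind : C * (phaseBox R).indicator (fun z => |f j z - f₀ z|) z =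
        (phaseBox R).indicator (fun _ => C) z * |f j z - f₀ z| := by
      by_cases hz : z ∈ phaseBox R <;> simp [hz]
    rw [hind, ← mul_sub, norm_mul, Real.norm_of_nonneg (hΦ0 z), Real.norm_eq_abs]
    by_cases hz : f j z = 0 ∧ f₀ z = 0
    · simp [hz.1, hz.2]
    · have hL : L₀ ≤ angMomSq z := by
        rcases not_and_or.1 hz with h | h
        · exact a1 h
        · exact b1 h
      have habs : |f j z - f₀ z| ≤ f j z + f₀ z := by
        rw [abs_le]
        constructor <;> linarith
      calc Φ z * |f j z - f₀ z|
          ≤ (ε / (2 * T) * (1 + ‖z.2‖ ^ 2) + (phaseBox R).indicator (fun _ => C) z)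
              * |f j z - f₀ z| := by
            gcongr
            exact hle z hL
        _ = ε / (2 * T) * (1 + ‖z.2‖ ^ 2) * |f j z - f₀ z|
              + (phaseBox R).indicator (fun _ => C) z * |f j z - f₀ z| := by ring
        _ ≤ ε / (2 * T) * (1 + ‖z.2‖ ^ 2) * (f j z + f₀ z)
              + (phaseBox R).indicator (fun _ => C) z * |f j z - f₀ z| := by gcongr
        _ = _ := by ring
  have hJ1 : Integrable fun z : Phase =>
      (f j z + f₀ z) + (‖z.2‖ ^ 2 * f j z + ‖z.2‖ ^ 2 * f₀ z) :=
    ((hf j).integrable.add hf₀.integrable).add ((hf j).integrable_kin.add hf₀.integrable_kin)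
  have hJ2 : Integrable fun z => (phaseBox R).indicator (fun z => |f j z - f₀ z|) z :=
    (((hf j).integrable.sub hf₀.integrable).abs).indicator (measurableSet_phaseBox R)
  have hval : ∫ z : Phase, ((f j z + f₀ z) + (‖z.2‖ ^ 2 * f j z + ‖z.2‖ ^ 2 * f₀ z)) =
      (M + M₀) + (kin (f j) + kin f₀) := by
    have hJ3 : Integrable fun z : Phase => f j z + f₀ z := (hf j).integrable.add hf₀.integrable
    have hJ4 : Integrable fun z : Phase => ‖z.2‖ ^ 2 * f j z + ‖z.2‖ ^ 2 * f₀ z :=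
      (hf j).integrable_kin.add hf₀.integrable_kin
    rw [integral_add hJ3 hJ4, integral_add (hf j).integrable hf₀.integrable,
      integral_add (hf j).integrable_kin hf₀.integrable_kin, (hf j).mass, hf₀.mass]
    rfl
  rw [Real.dist_eq, ← integral_sub (hI j) hI₀, ← Real.norm_eq_abs]
  calc ‖∫ z, (Φ z * f j z - Φ z * f₀ z)‖
      ≤ ∫ z : Phase, (ε / (2 * T) * ((f j z + f₀ z) + (‖z.2‖ ^ 2 * f j z + ‖z.2‖ ^ 2 * f₀ z))
        + C * (phaseBox R).indicator (fun z => |f j z - f₀ z|) z) :=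
        norm_integral_le_of_norm_le ((hJ1.const_mul _).add (hJ2.const_mul _)) hbound
    _ = ε / (2 * T) * ((M + M₀) + (kin (f j) + kin f₀))
        + C * ∫ z in phaseBox R, |f j z - f₀ z| := by
        rw [integral_add (hJ1.const_mul _) (hJ2.const_mul _), integral_const_mul,
          integral_const_mul, hval, integral_indicator (measurableSet_phaseBox R)]
    _ ≤ ε / (2 * T) * T + C * (ε / (4 * (C + 1))) := by
        gcongr
        have := hK j
        linarith
    _ < ε := by
        have e1 : ε / (2 * T) * T = ε / 2 := by field_simp
        have e2 : C * (ε / (4 * (C + 1))) ≤ ε / 4 := by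
          rw [mul_div_assoc', div_le_div_iff₀ (by positivity) (by norm_num)]
          nlinarith
        linarith

theorem tendsto_massIn (hk : 0 < k) (hl : 0 < l) (hL₀ : 0 < L₀)
    (hf : ∀ j, Admissible k l L₀ M (f j)) {K : ℝ} (hK : ∀ j, kin (f j) ≤ K) {M₀ : ℝ}
    (hf₀ : Admissible k l L₀ M₀ f₀)
    (hlim : Tendsto (fun j => eLpNorm (f j - f₀) (expo k) (weightedMeasure k l L₀)) atTop (𝓝 0))
    (r : ℝ) :
    Tendsto (fun j => massIn (rho (f j)) r) atTop (𝓝 (massIn (rho f₀) r)) := by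
  set S : Set Phase := Metric.closedBall (0 : R3) r ×ˢ Set.univ with hSdef
  have hS : MeasurableSet S := measurableSet_closedBall.prod MeasurableSet.univ
  have e : ∀ g : Phase → ℝ, Integrable g →
      massIn (rho g) r = ∫ z, S.indicator (fun _ => (1 : ℝ)) z * g z := by
    intro g hg
    rw [massIn_rho hg, ← integral_indicator hS]
    congr 1
    ext z
    by_cases hz : z ∈ S
    · rw [Set.indicator_of_mem hz, Set.indicator_of_mem hz, one_mul]
    · rw [Set.indicator_of_notMem hz, Set.indicator_of_notMem hz, zero_mul]
  rw [e f₀ hf₀.integrable]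
  simp only [fun j => e (f j) (hf j).integrable]
  refine tendsto_moment hk hl hL₀ hf hK hf₀ hlim (measurable_const.indicator hS)
    (fun z => Set.indicator_nonneg (fun _ _ => zero_le_one) z) fun ε hε => ?_
  -- A point with `|x| ≤ r` outside the box has `|v| > R ≥ 1`, hence `|v|² ≥ R ≥ ε⁻¹`.
  refine ⟨max (max r 1) ε⁻¹, by positivity, 1, zero_le_one, fun z _ => ?_⟩
  set R := max (max r 1) ε⁻¹ with hR
  have hR1 : 1 ≤ R := (le_max_right _ _).trans (le_max_left _ _)
  have hRr : r ≤ R := (le_max_left _ _).trans (le_max_left _ _)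
  have hRε : ε⁻¹ ≤ R := le_max_right _ _
  by_cases hz : z ∈ S
  · rw [Set.indicator_of_mem hz]
    by_cases hB : z ∈ phaseBox R
    · rw [Set.indicator_of_mem hB]
      have : 0 ≤ ε * (1 + ‖z.2‖ ^ 2) := by positivity
      linarith
    · rw [Set.indicator_of_notMem hB, add_zero]
      have hx : ‖z.1‖ ≤ R := by
        have : ‖z.1‖ ≤ r := by simpa [S] using hz
        linarith
      have hv : R < ‖z.2‖ := by
        by_contra hcon
        exact hB (mem_phaseBox.2 ⟨hx, not_lt.1 hcon⟩)
      calc (1 : ℝ) = ε * ε⁻¹ := (mul_inv_cancel₀ hε.ne').symm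
        _ ≤ ε * (1 + ‖z.2‖ ^ 2) := by
          gcongr
          nlinarith
  · rw [Set.indicator_of_notMem hz]
    have : 0 ≤ (phaseBox R).indicator (fun _ => (1 : ℝ)) z :=
      Set.indicator_nonneg (fun _ _ => zero_le_one) z
    positivity

theorem tendsto_invMoment (hk : 0 < k) (hl : 0 < l) (hL₀ : 0 < L₀)
    (hf : ∀ j, Admissible k l L₀ M (f j)) {K : ℝ} (hK : ∀ j, kin (f j) ≤ K) {M₀ : ℝ}
    (hf₀ : Admissible k l L₀ M₀ f₀)
    (hlim : Tendsto (fun j => eLpNorm (f j - f₀) (expo k) (weightedMeasure k l L₀)) atTop (𝓝 0)) :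
    Tendsto (fun j => invMoment (f j)) atTop (𝓝 (invMoment f₀)) := by
  refine tendsto_moment hk hl hL₀ hf hK hf₀ hlim (by fun_prop) (fun z => by positivity)
    fun ε hε => ?_
  set s := √L₀ with hs
  have hs0 : 0 < s := Real.sqrt_pos.2 hL₀
  have hinv : ∀ z : Phase, L₀ ≤ angMomSq z → ‖z.1‖⁻¹ ≤ ‖z.2‖ / s := by
    intro z hz
    have h := inv_norm_sq_le hL₀ hz
    rw [← Real.sq_sqrt hL₀.le, ← div_pow] at h
    exact le_of_sq_le_sq h (by positivity)
  -- Outside the box either `|x|` is large and `1/|x| ≤ ε`, or `|v|` is large and `1/|x| ≤ |v|/s ≤ ε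
  -- |v|²`. Inside it, `1/|x| ≤ |v|/s` is bounded, so the singularity at the origin does no harm.
  set R := max ε⁻¹ (ε⁻¹ / s) with hR
  have hR0 : 0 < R := by positivity
  refine ⟨R, hR0, R / s, by positivity, fun z hz => ?_⟩
  have hz' := hinv z hz
  by_cases hB : z ∈ phaseBox R
  · rw [Set.indicator_of_mem hB]
    have h1 : ‖z.2‖ / s ≤ R / s := by
      gcongr
      exact (mem_phaseBox.1 hB).2
    have : 0 ≤ ε * (1 + ‖z.2‖ ^ 2) := by positivity
    linarith
  · rw [Set.indicator_of_notMem hB, add_zero]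
    rw [mem_phaseBox, not_and_or, not_le, not_le] at hB
    rcases hB with h | h
    · have h1 : ε⁻¹ ≤ ‖z.1‖ := (le_max_left _ _).trans h.le
      have h2 : ‖z.1‖⁻¹ ≤ ε := inv_le_of_inv_le₀ hε h1
      nlinarith [sq_nonneg ‖z.2‖]
    · have h1 : ε⁻¹ / s ≤ ‖z.2‖ := (le_max_right _ _).trans h.le
      have h2 : 1 / s ≤ ε * ‖z.2‖ := by
        have := mul_le_mul_of_nonneg_left h1 hε.le
        rwa [← mul_div_assoc, mul_inv_cancel₀ hε.ne'] at this
      calc ‖z.1‖⁻¹ ≤ ‖z.2‖ / s := hz'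
        _ = 1 / s * ‖z.2‖ := by ring
        _ ≤ ε * ‖z.2‖ * ‖z.2‖ := by gcongr
        _ ≤ ε * (1 + ‖z.2‖ ^ 2) := by nlinarith

theorem tendsto_cas (hk : 0 < k) (hf : ∀ j, Admissible k l L₀ M (f j)) {M₀ : ℝ}
    (hf₀ : Admissible k l L₀ M₀ f₀)
    (hlim : Tendsto (fun j => eLpNorm (f j - f₀) (expo k) (weightedMeasure k l L₀)) atTop (𝓝 0)) :
    Tendsto (fun j => cas k l L₀ (f j)) atTop (𝓝 (cas k l L₀ f₀)) := by
  have hp0 : 0 < (expo k).toReal := by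
    rw [toReal_expo hk]
    positivity
  have e : ∀ M g, ∀ hg : Admissible k l L₀ M g,
      cas k l L₀ g = ‖(hg.memLp hk).toLp g‖ ^ (expo k).toReal := by
    intro M g hg
    have hc := cas_nonneg (k := k) (l := l) (L₀ := L₀) hg.nonneg
    have hcas : ∫ z, ‖g z‖ ^ (expo k).toReal ∂weightedMeasure k l L₀ = cas k l L₀ g := by
      refine integral_congr_ae ?_
      filter_upwards [hg.ae_weighted_nonneg] with z hz
      rw [Real.norm_of_nonneg hz]
    rw [Lp.norm_toLp, (hg.memLp hk).eLpNorm_eq_integral_rpow_norm expo_ne_zero expo_ne_top, hcas,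
      ENNReal.toReal_ofReal (by positivity), Real.rpow_inv_rpow hc hp0.ne']
  have ht := (Lp.tendsto_Lp_iff_tendsto_eLpNorm'' f (fun j => (hf j).memLp hk) f₀
    (hf₀.memLp hk)).2 hlim
  rw [e _ _ hf₀]
  simp only [fun j => e _ _ (hf j)]
  exact ht.norm.rpow_const (Or.inr hp0.le)

theorem exists_subseq_tendsto_ae (hk : 0 < k) (hl : 0 < l)
    (hf : ∀ j, Admissible k l L₀ M (f j)) (hf₀ : MemLp f₀ (expo k) (weightedMeasure k l L₀))
    (hlim : Tendsto (fun j => eLpNorm (f j - f₀) (expo k) (weightedMeasure k l L₀)) atTop (𝓝 0)) :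
    ∃ t : ℕ → ℕ, StrictMono t ∧ ∀ᵐ z : Phase, Tendsto (fun j => f (t j) z) atTop (𝓝 (f₀ z)) := by
  have hmeas := tendstoInMeasure_of_tendsto_eLpNorm expo_ne_zero
    (fun j => ((hf j).memLp hk).1) hf₀.1 hlim
  obtain ⟨t, ht, hae⟩ := hmeas.exists_seq_tendsto_ae
  exact ⟨t, ht, (volume_ac_weightedMeasure hk hl).ae_le hae⟩

theorem SphSymm.of_tendsto_ae (hf : ∀ j, SphSymm (f j))
    (hlim : ∀ᵐ z : Phase, Tendsto (fun j => f j z) atTop (𝓝 (f₀ z))) : SphSymm f₀ := by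
  intro A
  have hA : MeasurePreserving (fun z : Phase => (A z.1, A z.2)) := by
    rw [Measure.volume_eq_prod]
    exact A.measurePreserving.prod A.measurePreserving
  filter_upwards [hlim, hA.quasiMeasurePreserving.ae hlim, ae_all_iff.2 fun j => hf j A]
    with z h1 h2 h3
  exact tendsto_nhds_unique (h2.congr h3) h1

/-- Everything passes to the limit along an a.e. convergent subsequence. Fatou's lemma yields only
an inequality for the mass, since mass may escape to infinity. -/
theorem limit_admissible (hk : 0 < k) (hl : 0 < l)
    (hf : ∀ j, Admissible k l L₀ M (f j)) {K : ℝ} (hK : ∀ j, kin (f j) ≤ K)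
    (hf₀ : MemLp f₀ (expo k) (weightedMeasure k l L₀))
    (hlim : Tendsto (fun j => eLpNorm (f j - f₀) (expo k) (weightedMeasure k l L₀)) atTop (𝓝 0)) :
    Admissible k l L₀ (∫ z, f₀ z) f₀ ∧ ∫ z, f₀ z ≤ M ∧
      ∀ c, Tendsto (fun j => kin (f j)) atTop (𝓝 c) → kin f₀ ≤ c := by
  obtain ⟨t, ht, hae⟩ := exists_subseq_tendsto_ae hk hl hf hf₀ hlim
  have hm : AEStronglyMeasurable f₀ volume := hf₀.1.mono_ac (volume_ac_weightedMeasure hk hl)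
  have hall := ae_all_iff.2 fun j => (hf (t j)).nonneg
  obtain ⟨hint, hmass⟩ := integrable_and_integral_le_of_tendsto_ae
    (fun j => (hf (t j)).integrable) (fun j => (hf (t j)).nonneg) hm hae (K := M)
    (Eventually.of_forall fun j => (hf (t j)).mass.le)
  have hkin : ∀ c, (∀ᶠ j in atTop, kin (f (t j)) ≤ c) →
      Integrable (fun z : Phase => ‖z.2‖ ^ 2 * f₀ z) ∧ kin f₀ ≤ c := fun c hc =>
    integrable_and_integral_le_of_tendsto_ae (fun j => (hf (t j)).integrable_kin)
      (fun j => by filter_upwards [(hf (t j)).nonneg] with z hz; positivity)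
      ((by fun_prop : Continuous fun z : Phase => ‖z.2‖ ^ 2).aestronglyMeasurable.mul hm)
      (by filter_upwards [hae] with z hz using hz.const_mul _) hc
  refine ⟨Admissible.of_integrable hk hint ?_ (SphSymm.of_tendsto_ae (fun j => (hf (t j)).sphSymm)
    hae) rfl (hkin K (Eventually.of_forall fun j => hK _)).1 hf₀ ?_, hmass, fun c hc => ?_⟩
  · filter_upwards [hae, hall] with z h1 h2 using ge_of_tendsto' h1 h2
  · filter_upwards [hae, ae_all_iff.2 fun j => (hf (t j)).vanish] with z h1 h2 hz
    exact tendsto_nhds_unique h1 (by simp [h2 _ hz])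
  · refine le_of_forall_pos_le_add fun ε hε => (hkin (c + ε) ?_).2
    exact (hc.comp ht.tendsto_atTop).eventually_le_const (by linarith)

theorem energyReal_limit_le {Mc : ℝ} (hk : 0 < k) (hl : 0 < l) (hL₀ : 0 < L₀)
    (hf : ∀ j, Admissible k l L₀ M (f j)) {K : ℝ} (hK : ∀ j, kin (f j) ≤ K)
    (hf₀ : MemLp f₀ (expo k) (weightedMeasure k l L₀))
    (hlim : Tendsto (fun j => eLpNorm (f j - f₀) (expo k) (weightedMeasure k l L₀)) atTop (𝓝 0))
    {h : ℝ} (hE : Tendsto (fun j => energyReal k l L₀ Mc (f j)) atTop (𝓝 h)) :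
    energyReal k l L₀ Mc f₀ ≤ h := by
  obtain ⟨ha, -, hkin⟩ := limit_admissible hk hl hf hK hf₀ hlim
  have h1 := tendsto_fieldSq hL₀ hf hK (tendsto_massIn hk hl hL₀ hf hK ha hlim)
  have h2 := tendsto_invMoment hk hl hL₀ hf hK ha hlim
  have h3 := tendsto_cas hk hf ha hlim
  -- All other terms of the energy converge, so the kinetic energies converge too; lower
  -- semicontinuity is applied with that limit.
  have h4 := ((hE.sub h3).add ((h1.const_mul (1 / (8 * Real.pi))).add (h2.const_mul Mc))).const_mul 2
  have h5 := hkin _ (h4.congr fun j => by simp only [energyReal]; ring)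
  simp only [energyReal]
  linarith

end Limit

/-! ### Distant test clouds -/

/-- A shell in phase space at distance `R` with velocities of size `u` and angular momentum at
least `R u`. -/
def shell (R u : ℝ) : Set Phase :=
  {z | R ≤ ‖z.1‖ ∧ ‖z.1‖ ≤ 2 * R ∧ ‖z.2‖ ≤ 2 * u ∧ (R * u) ^ 2 ≤ angMomSq z}

theorem mem_shell {R u : ℝ} {z : Phase} : z ∈ shell R u ↔
    R ≤ ‖z.1‖ ∧ ‖z.1‖ ≤ 2 * R ∧ ‖z.2‖ ≤ 2 * u ∧ (R * u) ^ 2 ≤ angMomSq z := Iff.rfl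

theorem measurableSet_shell (R u : ℝ) : MeasurableSet (shell R u) := by
  have h : IsClosed (shell R u) :=
    (isClosed_le continuous_const continuous_fst.norm).and
      ((isClosed_le continuous_fst.norm continuous_const).and
        ((isClosed_le continuous_snd.norm continuous_const).and
          (isClosed_le continuous_const continuous_angMomSq)))
  exact h.measurableSet

theorem volume_shell_lt_top (R u : ℝ) : volume (shell R u) < ∞ := by
  refine lt_of_le_of_lt (measure_mono ?_) (volume_phaseBox_lt_top (max (2 * R) (2 * u)))
  intro z hz
  exact mem_phaseBox.2 ⟨hz.2.1.trans (le_max_left _ _), hz.2.2.1.trans (le_max_right _ _)⟩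

theorem angMomSq_smul (a b : ℝ) (z : Phase) :
    angMomSq (a • z.1, b • z.2) = (a * b) ^ 2 * angMomSq z := by
  simp only [angMomSq, norm_smul, inner_smul_left, inner_smul_right, mul_pow, Real.norm_eq_abs,
    sq_abs, conj_trivial]
  ring

/-- The map `(x, v) ↦ (R x, u v)` carries the unit shell onto the given one and has determinant `(R
u)³`. -/
theorem volume_shell {R u : ℝ} (hR : 0 < R) (hu : 0 < u) :
    (volume (shell R u)).toReal = (R * u) ^ 3 * (volume (shell 1 1)).toReal := by
  set T : Phase →ₗ[ℝ] Phase :=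
    (R • LinearMap.id : R3 →ₗ[ℝ] R3).prodMap (u • LinearMap.id : R3 →ₗ[ℝ] R3) with hT
  have hdet : LinearMap.det T = (R * u) ^ 3 := by
    rw [hT, LinearMap.det_prodMap, LinearMap.det_smul, LinearMap.det_smul]
    simp [mul_pow]
  have hpre : T ⁻¹' shell R u = shell 1 1 := by
    ext z
    have hz : T z = (R • z.1, u • z.2) := rfl
    rw [Set.mem_preimage, hz, mem_shell, mem_shell, angMomSq_smul]
    simp only [norm_smul, Real.norm_of_nonneg hR.le, Real.norm_of_nonneg hu.le]
    refine and_congr ?_ (and_congr ?_ (and_congr ?_ ?_))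
    · exact le_mul_iff_one_le_right hR
    · rw [mul_comm 2 R, mul_le_mul_iff_right₀ hR, mul_one]
    · rw [mul_comm 2 u, mul_le_mul_iff_right₀ hu, mul_one]
    · rw [le_mul_iff_one_le_right (by positivity)]
      norm_num
  have : (volume : Measure Phase).IsAddHaarMeasure := by
    rw [Measure.volume_eq_prod]
    infer_instance
  have h := Measure.addHaar_preimage_linearMap (volume : Measure Phase)
    (f := T) (by rw [hdet]; positivity) (shell R u)
  rw [hpre, hdet, abs_of_pos (by positivity)] at h
  rw [h, ENNReal.toReal_mul, ENNReal.toReal_ofReal (by positivity)]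
  field_simp

theorem volume_shell_one_pos : 0 < (volume (shell 1 1)).toReal := by
  refine ENNReal.toReal_pos ?_ (volume_shell_lt_top 1 1).ne
  set U : Set Phase := {z | 1 < ‖z.1‖ ∧ ‖z.1‖ < 2 ∧ ‖z.2‖ < 2 ∧ 1 < angMomSq z} with hU
  have hopen : IsOpen U :=
    (isOpen_lt continuous_const continuous_fst.norm).and
      ((isOpen_lt continuous_fst.norm continuous_const).and
        ((isOpen_lt continuous_snd.norm continuous_const).and
          (isOpen_lt continuous_const continuous_angMomSq)))
  have hne : U.Nonempty := by
    refine ⟨((3 / 2 : ℝ) • EuclideanSpace.single 0 1, (3 / 2 : ℝ) • EuclideanSpace.single 1 1), ?_⟩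
    have h := angMomSq_smul (3 / 2) (3 / 2)
      ((EuclideanSpace.single 0 1 : R3), (EuclideanSpace.single 1 1 : R3))
    simp only [hU, Set.mem_ofPred_eq, h]
    have h1 : angMomSq ((EuclideanSpace.single 0 1 : R3), (EuclideanSpace.single 1 1 : R3)) = 1 := by
      simp [angMomSq, EuclideanSpace.inner_single_left]
    rw [h1]
    norm_num [norm_smul]
  have hsub : U ⊆ shell 1 1 := fun z hz =>
    ⟨hz.1.le, by linarith [hz.2.1], by linarith [hz.2.2.1], by linarith [hz.2.2.2]⟩
  have hpos : 0 < volume U := by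
    rw [Measure.volume_eq_prod]
    exact hopen.measure_pos _ hne
  exact (hpos.trans_le (measure_mono hsub)).ne'

/-- A far away test particle cloud of mass `m`. -/
theorem exists_test_cloud {k l L₀ m : ℝ} (hk : 0 < k) (hl : 0 < l) (hL₀ : 0 < L₀) (hm : 0 < m) :
    ∃ c : ℝ, ∀ R u : ℝ, 0 < R → 0 < u → 2 * L₀ ≤ (R * u) ^ 2 →
      ∃ g, Admissible k l L₀ m g ∧ kin g ≤ 4 * u ^ 2 * m ∧ m / (2 * R) ≤ invMoment g ∧
        cas k l L₀ g ≤ c * (R * u) ^ (-((3 + 2 * l) / k)) := by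
  set V₁ := (volume (shell 1 1)).toReal with hV₁
  have hV₁0 : 0 < V₁ := volume_shell_one_pos
  set p := (expo k).toReal with hp
  have hpk : p = 1 + 1 / k := toReal_expo hk
  -- The cloud has constant density `m / V` on the shell, so its Casimir value is at most `(m / V)^p
  -- w V = m^p V^(-1/k) w`. Inserting `V = T³ V₁` and `w = (T²/2)^(-l/k)` gives this constant times
  -- `T^(-(3+2l)/k)`.
  refine ⟨m ^ p * V₁ ^ (-(1 / k)) * (1 / 2) ^ (-(l / k)), fun R u hR hu hRu => ?_⟩
  set S := shell R u with hS
  have hSm : MeasurableSet S := measurableSet_shell R u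
  set V := (volume S).toReal with hV
  have hVeq : V = (R * u) ^ 3 * V₁ := volume_shell hR hu
  have hV0 : 0 < V := by rw [hVeq]; positivity
  have hreal : volume.real S = V := rfl
  have hSfin : volume S ≠ ∞ := (volume_shell_lt_top R u).ne
  set T := R * u with hT
  have hT0 : 0 < T := by positivity
  set w := ((1 / 2 : ℝ) * T ^ 2) ^ (-(l / k)) with hw
  have hw0 : 0 < w := by positivity
  have hweight : ∀ z ∈ S, weight k l L₀ z ≤ ENNReal.ofReal w := by
    intro z hz
    -- `2 L₀ ≤ T²` keeps the shell well inside `{L > L₀}`, where the weight is finite.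
    have h1 : 1 / 2 * T ^ 2 ≤ angMomSq z - L₀ := by linarith [hz.2.2.2]
    have h2 : 0 < angMomSq z - L₀ := lt_of_lt_of_le (by positivity) h1
    rw [weight, ENNReal.ofReal_rpow_of_pos h2]
    refine ENNReal.ofReal_le_ofReal ?_
    exact Real.rpow_le_rpow_of_nonpos (by positivity) h1 (by
      have : 0 < l / k := by positivity
      linarith)
  have hνS : weightedMeasure k l L₀ S ≤ ENNReal.ofReal (w * V) := by
    rw [weightedMeasure, withDensity_apply _ hSm, ENNReal.ofReal_mul hw0.le, hV,
      ENNReal.ofReal_toReal hSfin, ← setLIntegral_const]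
    exact setLIntegral_mono measurable_const hweight
  have hνfin : weightedMeasure k l L₀ S ≠ ∞ := (hνS.trans_lt ENNReal.ofReal_lt_top).ne
  set a := m / V with ha
  have ha0 : 0 < a := by positivity
  set g : Phase → ℝ := S.indicator fun _ => a with hg
  have hg0 : ∀ z, 0 ≤ g z := Set.indicator_nonneg fun _ _ => ha0.le
  have hgint : Integrable g := (integrable_indicator_iff hSm).2 (integrableOn_const hSfin)
  have hgmass : ∫ z, g z = m := by
    rw [hg, integral_indicator hSm, setIntegral_const, hreal, smul_eq_mul, ha]
    field_simp
  have hkle : ∀ z, ‖z.2‖ ^ 2 * g z ≤ 4 * u ^ 2 * g z := by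
    intro z
    by_cases hz : z ∈ S
    · have h1 : ‖z.2‖ ^ 2 ≤ (2 * u) ^ 2 := by
        gcongr
        exact hz.2.2.1
      have := hg0 z
      nlinarith
    · rw [hg, Set.indicator_of_notMem hz]
      simp
  have hkint : Integrable fun z : Phase => ‖z.2‖ ^ 2 * g z := by
    refine (hgint.const_mul (4 * u ^ 2)).mono'
      ((by fun_prop : Continuous fun z : Phase => ‖z.2‖ ^ 2).aestronglyMeasurable.mul hgint.1)
      (Eventually.of_forall fun z => ?_)
    have := hg0 z
    rw [Real.norm_of_nonneg (by positivity)]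
    exact hkle z
  have hsymm : SphSymm g := by
    refine fun A => Eventually.of_forall fun z => ?_
    have hmem : (A z.1, A z.2) ∈ S ↔ z ∈ S := by
      simp only [hS, mem_shell, angMomSq, LinearIsometryEquiv.norm_map,
        LinearIsometryEquiv.inner_map_map]
    by_cases hz : z ∈ S
    · rw [hg, Set.indicator_of_mem hz, Set.indicator_of_mem (hmem.2 hz)]
    · rw [hg, Set.indicator_of_notMem hz, Set.indicator_of_notMem (fun h => hz (hmem.1 h))]
  have hadm : Admissible k l L₀ m g := by
    refine Admissible.of_integrable hk hgint (Eventually.of_forall hg0) hsymm hgmass hkint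
      (memLp_indicator_const _ hSm _ (Or.inr hνfin)) (Eventually.of_forall fun z hz => ?_)
    refine Set.indicator_of_notMem (fun h => ?_) _
    have := h.2.2.2
    linarith
  refine ⟨g, hadm, ?_, ?_, ?_⟩
  · calc kin g ≤ ∫ z, 4 * u ^ 2 * g z := integral_mono hkint (hgint.const_mul _) hkle
      _ = 4 * u ^ 2 * m := by rw [integral_const_mul, hgmass]
  · calc m / (2 * R) = ∫ z, (2 * R)⁻¹ * g z := by
          rw [integral_const_mul, hgmass, div_eq_inv_mul]
      _ ≤ invMoment g := by
          refine integral_mono (hgint.const_mul _) (hadm.integrable_inv hL₀) fun z => ?_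
          by_cases hz : z ∈ S
          · have h1 : 0 < ‖z.1‖ := lt_of_lt_of_le hR hz.1
            have h2 : (2 * R)⁻¹ ≤ ‖z.1‖⁻¹ := by
              gcongr
              exact hz.2.1
            exact mul_le_mul_of_nonneg_right h2 (hg0 z)
          · simp only [hg, Set.indicator_of_notMem hz]
            simp
  · have hp0 : p ≠ 0 := by
      rw [hpk]
      positivity
    have e1 : (fun z => g z ^ p) = S.indicator fun _ => a ^ p := by
      ext z
      by_cases hz : z ∈ S
      · simp only [hg, Set.indicator_of_mem hz]
      · simp only [hg, Set.indicator_of_notMem hz, Real.zero_rpow hp0]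
    have e2 : cas k l L₀ g = (weightedMeasure k l L₀).real S * a ^ p := by
      rw [cas, e1, integral_indicator hSm, setIntegral_const, smul_eq_mul]
    have e3 : (weightedMeasure k l L₀).real S ≤ w * V :=
      ENNReal.toReal_le_of_le_ofReal (by positivity) hνS
    calc cas k l L₀ g ≤ w * V * a ^ p := by
          rw [e2]
          gcongr
      _ = m ^ p * V ^ (-(1 / k)) * w := by
          rw [ha, Real.div_rpow hm.le hV0.le, hpk, Real.rpow_add hV0, Real.rpow_one,
            Real.rpow_neg hV0.le]
          field_simp
      _ = m ^ p * V₁ ^ (-(1 / k)) * (1 / 2) ^ (-(l / k)) * T ^ (-((3 + 2 * l) / k)) := by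
          rw [hVeq, hw, Real.mul_rpow (by positivity) hV₁0.le,
            Real.mul_rpow (by norm_num) (by positivity), ← Real.rpow_natCast T 3,
            ← Real.rpow_natCast T 2, ← Real.rpow_mul hT0.le, ← Real.rpow_mul hT0.le]
          have : T ^ (-((3 + 2 * l) / k)) =
              T ^ (((3 : ℕ) : ℝ) * -(1 / k)) * T ^ (((2 : ℕ) : ℝ) * -(l / k)) := by
            rw [← Real.rpow_add hT0]
            congr 1
            push_cast
            ring
          rw [this]
          ring

/-! ### Adding mass far away -/

section Superposition

variable {k l L₀ M m : ℝ} {f g : Phase → ℝ}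

theorem Admissible.add (hf : Admissible k l L₀ M f) (hg : Admissible k l L₀ m g) (hk : 0 < k) :
    Admissible k l L₀ (M + m) fun z => f z + g z := by
  refine Admissible.of_integrable hk (hf.integrable.add hg.integrable) ?_
    (hf.sphSymm.add hg.sphSymm) ?_ ?_ ((hf.memLp hk).add (hg.memLp hk)) ?_
  · filter_upwards [hf.nonneg, hg.nonneg] with z h1 h2
    positivity
  · rw [integral_add hf.integrable hg.integrable, hf.mass, hg.mass]
  · refine (hf.integrable_kin.add hg.integrable_kin).congr (Eventually.of_forall fun z => ?_)
    simp only [Pi.add_apply]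
    ring
  · filter_upwards [hf.vanish, hg.vanish] with z h1 h2 h
    rw [h1 h, h2 h, add_zero]

theorem kin_add (hf : Admissible k l L₀ M f) (hg : Admissible k l L₀ m g) :
    kin (fun z => f z + g z) = kin f + kin g := by
  simp only [kin, mul_add]
  exact integral_add hf.integrable_kin hg.integrable_kin

theorem invMoment_add (hf : Admissible k l L₀ M f) (hg : Admissible k l L₀ m g) (hL₀ : 0 < L₀) :
    invMoment (fun z => f z + g z) = invMoment f + invMoment g := by
  simp only [invMoment, mul_add]
  exact integral_add (hf.integrable_inv hL₀) (hg.integrable_inv hL₀)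

/-- Enclosed masses add and are nonnegative, so the field strength can only increase at each point.
-/
theorem fieldSq_le_fieldSq_add (hf : Admissible k l L₀ M f) (hg : Admissible k l L₀ m g)
    (hk : 0 < k) (hL₀ : 0 < L₀) : fieldSq f ≤ fieldSq fun z => f z + g z := by
  refine integral_mono (hf.integrable_gradU_sq hL₀) ((hf.add hg hk).integrable_gradU_sq hL₀)
    fun x => ?_
  have h1 := hf.massIn_nonneg ‖x‖
  have h2 := hg.massIn_nonneg ‖x‖
  simp only [gradU_eq_radialField, norm_radialField, massIn_rho_add hf.integrable hg.integrable,
    Pi.add_apply]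
  rw [abs_of_nonneg h1, abs_of_nonneg (add_nonneg h1 h2)]
  gcongr
  linarith

theorem cas_add_le (hf : Admissible k l L₀ M f) (hg : Admissible k l L₀ m g) (hk : 0 < k) {θ : ℝ}
    (hθ : 0 < θ) (hθ1 : θ < 1) :
    cas k l L₀ (fun z => f z + g z) ≤
      (1 - θ) ^ (-(1 / k)) * cas k l L₀ f + θ ^ (-(1 / k)) * cas k l L₀ g := by
  have hp : (expo k).toReal = 1 + 1 / k := toReal_expo hk
  have hk' : 0 < 1 / k := by positivity
  have h1 := integrable_rpow_expo (hf.memLp hk) hf.nonneg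
  have h2 := integrable_rpow_expo (hg.memLp hk) hg.nonneg
  simp only [cas]
  rw [← integral_const_mul, ← integral_const_mul,
    ← integral_add (h1.const_mul _) (h2.const_mul _)]
  refine integral_mono_ae (integrable_rpow_expo ((hf.add hg hk).memLp hk) (hf.add hg hk).nonneg)
    ((h1.const_mul _).add (h2.const_mul _)) ?_
  filter_upwards [hf.ae_weighted_nonneg, hg.ae_weighted_nonneg] with z a0 b0
  have h := convex_comb_rpow_le (p := (expo k).toReal) (by rw [hp]; linarith) a0 b0 hθ hθ1
  rwa [show 1 - (expo k).toReal = -(1 / k) by rw [hp]; ring] at h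

end Superposition

/-- From `(1 - θ)⁻¹ ≤ exp (2θ)` for `θ ≤ 1/2`, and `exp x - 1 ≤ 2x` for `0 ≤ x ≤ 1`. -/
theorem one_sub_rpow_neg_le {a θ : ℝ} (ha : 0 < a) (hθ : 0 < θ) (hθ1 : θ ≤ 1 / 2)
    (hθa : 2 * θ * a ≤ 1) : (1 - θ) ^ (-a) ≤ 1 + 4 * θ * a := by
  have h1 : 0 < 1 - θ := by linarith
  have h2 : (1 - θ)⁻¹ ≤ Real.exp (2 * θ) := by
    refine le_trans ?_ (Real.add_one_le_exp _)
    rw [inv_le_iff_one_le_mul₀ h1]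
    nlinarith
  rw [Real.rpow_neg h1.le, ← Real.inv_rpow h1.le]
  calc (1 - θ)⁻¹ ^ a ≤ Real.exp (2 * θ) ^ a := by gcongr
    _ = Real.exp (2 * θ * a) := by rw [← Real.exp_mul]
    _ ≤ 1 + 4 * θ * a := by
      have h3 : |2 * θ * a| ≤ 1 := by
        rw [abs_of_pos (by positivity)]
        exact hθa
      have h4 := (le_abs_self _).trans (Real.abs_exp_sub_one_le h3)
      rw [abs_of_pos (by positivity)] at h4
      linarith

/-- Adding mass far away lowers the energy strictly. -/
theorem exists_energyReal_lt {k l L₀ Mc M m : ℝ} (hk : 0 < k) (hkl : k ≤ l) (hL₀ : 0 < L₀)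
    (hMc : 0 < Mc) (hm : 0 < m) {f : Phase → ℝ} (hf : Admissible k l L₀ M f) :
    ∃ f', Admissible k l L₀ (M + m) f' ∧ energyReal k l L₀ Mc f' < energyReal k l L₀ Mc f := by
  have hl : 0 < l := hk.trans_le hkl
  have hpi := Real.pi_pos
  obtain ⟨c, hc⟩ := exists_test_cloud (l := l) hk hl hL₀ hm
  set C := cas k l L₀ f with hC
  have hC0 : 0 ≤ C := cas_nonneg hf.nonneg
  set D := 2 * m + 4 * C / k with hD
  have hD0 : 0 < D := by positivity
  -- `D θ` bounds the kinetic cost plus the increase of the Casimir term of `f`. With `θ = η / R`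
  -- this is `Mc m/(8R)`, a quarter of the gain `Mc m/(2R)`.
  set η := Mc * m / (8 * D) with hη
  have hη0 : 0 < η := by positivity
  -- `-1 - γ = 1/k - (3 + 2l)/(2k)` is the power of `R` in the cloud's Casimir cost `E R^(-1-γ)`.
  -- Positivity of `γ`, where `k ≤ l` enters, makes that cost negligible against `1/R`.
  set γ := (1 + 2 * (l - k)) / (2 * k) with hγ
  have hγ0 : 0 < γ := div_pos (by linarith) (by positivity)
  set E := c * η ^ (-(1 / k) - (3 + 2 * l) / (2 * k)) with hE
  have hlim : Tendsto (fun R : ℝ => E * R ^ (-γ)) atTop (𝓝 (E * 0)) :=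
    (tendsto_rpow_neg_atTop hγ0).const_mul E
  rw [mul_zero] at hlim
  obtain ⟨R, hR1, hR2, hR3, hR4⟩ := ((hlim.eventually_lt_const
    (show (0 : ℝ) < Mc * m / 8 by positivity)).and
    ((eventually_ge_atTop (2 * η)).and ((eventually_ge_atTop (2 * η * (1 / k))).and
      (eventually_ge_atTop (2 * L₀ / η))))).exists
  have hR0 : 0 < R := lt_of_lt_of_le (by positivity) hR2
  -- The same `θ` is the convexity splitting parameter and the squared velocity scale `u²` of the
  -- cloud.
  set θ := η / R with hθ
  have hθ0 : 0 < θ := by positivity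
  have hθ1 : θ ≤ 1 / 2 := by
    rw [hθ, div_le_div_iff₀ hR0 (by norm_num)]
    linarith
  have hθk : 2 * θ * (1 / k) ≤ 1 := by
    have : 2 * θ * (1 / k) = 2 * η * (1 / k) / R := by rw [hθ]; ring
    rw [this, div_le_one hR0]
    exact hR3
  have hu0 : 0 < √θ := Real.sqrt_pos.2 hθ0
  have hu2 : √θ ^ 2 = θ := Real.sq_sqrt hθ0.le
  have hRu2 : (R * √θ) ^ 2 = R * η := by
    rw [mul_pow, hu2, hθ]
    field_simp
  obtain ⟨g, hg, hgk, hgi, hgc⟩ := hc R (√θ) hR0 hu0 (by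
    rw [hRu2]
    rwa [div_le_iff₀ hη0] at hR4)
  refine ⟨_, hf.add hg hk, ?_⟩
  have hcas := cas_add_le hf hg hk hθ0 (by linarith)
  have hone := one_sub_rpow_neg_le (a := 1 / k) (by positivity) hθ0 hθ1 hθk
  have hRu : (R * √θ) ^ (-((3 + 2 * l) / k)) = (R * η) ^ (-((3 + 2 * l) / (2 * k))) := by
    rw [← hRu2, ← Real.rpow_natCast, ← Real.rpow_mul (by positivity)]
    congr 1
    push_cast
    field_simp
  have hthird : θ ^ (-(1 / k)) * cas k l L₀ g ≤ E * R ^ (-γ) / R := by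
    calc θ ^ (-(1 / k)) * cas k l L₀ g
        ≤ θ ^ (-(1 / k)) * (c * (R * η) ^ (-((3 + 2 * l) / (2 * k)))) := by
          rw [← hRu]
          gcongr
      _ = E * R ^ (-γ) / R := by
          have e1 : R ^ (-γ) / R =
              (R ^ (-(1 / k)))⁻¹ * R ^ (-((3 + 2 * l) / (2 * k))) := by
            rw [← Real.rpow_neg hR0.le, ← Real.rpow_add hR0]
            nth_rewrite 2 [← Real.rpow_one R]
            rw [← Real.rpow_sub hR0]
            congr 1
            rw [hγ]
            field_simp
            ring
          rw [mul_div_assoc, e1, hθ, hE, Real.div_rpow hη0.le hR0.le, Real.mul_rpow hR0.le hη0.le,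
            sub_eq_add_neg, Real.rpow_add hη0]
          ring
  have hfield : 1 / (8 * Real.pi) * fieldSq f ≤
      1 / (8 * Real.pi) * fieldSq fun z => f z + g z := by
    gcongr
    exact fieldSq_le_fieldSq_add hf hg hk hL₀
  have hinv := mul_le_mul_of_nonneg_left hgi hMc.le
  have hsecond := mul_le_mul_of_nonneg_right hone hC0
  have hfin : 2 * θ * m + 4 * θ * (1 / k) * C + E * R ^ (-γ) / R < Mc * (m / (2 * R)) := by
    have e1 : 2 * θ * m + 4 * θ * (1 / k) * C + E * R ^ (-γ) / R =
        (η * D + E * R ^ (-γ)) / R := by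
      rw [hθ, hD]
      field_simp
    have e2 : Mc * (m / (2 * R)) = Mc * m / 2 / R := by field_simp
    have e3 : η * D = Mc * m / 8 := by
      rw [hη]
      field_simp
    rw [e1, e2, e3]
    have : 0 < Mc * m := by positivity
    gcongr
    linarith
  rw [hu2] at hgk
  simp only [energyReal]
  rw [kin_add hf hg, invMoment_add hf hg hL₀]
  linarith

end VlasovShell

/-! ### Existence of minimizers -/

theorem theorem5p1 (k l L₀ Mc M : ℝ) (hk : 0 < k) (hkl : k ≤ l) (hMc : 0 < Mc)
    (hM : 0 < M) (hL₀ : 0 < L₀) (f : ℕ → VlasovShell.Phase → ℝ)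
    (hf : VlasovShell.IsMinimizingSeq k l L₀ Mc M f) :
    ∃ (f₀ : VlasovShell.Phase → ℝ) (s : ℕ → ℕ),
      StrictMono s ∧
      VlasovShell.Admissible k l L₀ M f₀ ∧
      VlasovShell.energyCasimir k l L₀ Mc f₀ = VlasovShell.hInf k l L₀ Mc M ∧
      VlasovShell.WeakTendsto k l L₀ (fun j => f (s j)) f₀ ∧
      (∀ j, MemLp (VlasovShell.gradU (f (s j))) 2 volume) ∧
      MemLp (VlasovShell.gradU f₀) 2 volume ∧
      Tendsto (fun j => eLpNorm (VlasovShell.gradU (f (s j)) - VlasovShell.gradU f₀) 2 volume)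
        atTop (𝓝 0) := by
  open VlasovShell in
  obtain ⟨hadm, hmin⟩ := hf
  have hl : 0 < l := hk.trans_le hkl
  obtain ⟨h, hh, hle⟩ := exists_hInf_eq_coe hk hL₀ hMc (hadm 0)
  have hE : Tendsto (fun j => energyReal k l L₀ Mc (f j)) atTop (𝓝 h) := by
    rw [hh] at hmin
    simp only [fun j => (hadm j).energyCasimir_eq hk hL₀ hMc] at hmin
    exact EReal.tendsto_coe.1 hmin
  obtain ⟨E, hEbdd⟩ := hE.bddAbove_range
  obtain ⟨B, hB⟩ := exists_energyReal_ge k l M hL₀ hMc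
  have hbd : ∀ j, kin (f j) ≤ 4 * (E + B) ∧ cas k l L₀ (f j) ≤ 4 * (E + B) := by
    intro j
    have h1 := hB _ (hadm j)
    have h2 := hEbdd ⟨j, rfl⟩
    have h3 := (hadm j).kin_nonneg
    have h4 := cas_nonneg (k := k) (l := l) (L₀ := L₀) (hadm j).nonneg
    simp only at h2
    constructor <;> linarith
  obtain ⟨s, f₀, hs, hf₀, hlim⟩ := exists_subseq_tendsto_Lp hk hL₀ hadm hle hE
    (fun j => (hbd j).1) (fun j => (hbd j).2)
  have hadm' := fun j => hadm (s j)
  have hK := fun j => (hbd (s j)).1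
  obtain ⟨ha, hmass, -⟩ := limit_admissible hk hl hadm' hK hf₀ hlim
  have hEle := energyReal_limit_le hk hl hL₀ hadm' hK hf₀ hlim (hE.comp hs.tendsto_atTop)
  -- Lost mass could be put back far away, producing a function of mass `M` with energy below `h`.
  have hmassM : ∫ z, f₀ z = M := by
    refine hmass.eq_of_not_lt fun hlt => ?_
    obtain ⟨g, hg, hglt⟩ := exists_energyReal_lt hk hkl hL₀ hMc (sub_pos.2 hlt) ha
    rw [add_sub_cancel] at hg
    linarith [hle g hg]
  rw [hmassM] at ha
  have hmin₀ : energyReal k l L₀ Mc f₀ = h := le_antisymm hEle (hle f₀ ha)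
  refine ⟨f₀, s, hs, ha, ?_, ⟨fun j => (hadm' j).memLkl hk, ha.memLkl hk, fun φ => ?_⟩,
    fun j => (hadm' j).memLp_gradU hL₀, ha.memLp_gradU hL₀,
    tendsto_eLpNorm_gradU_sub hL₀ hadm' hK ha (tendsto_massIn hk hl hL₀ hadm' hK ha hlim)⟩
  · rw [ha.energyCasimir_eq hk hL₀ hMc, hh, hmin₀]
  -- Convergence is even strong in the weighted space, so every continuous functional converges.
  · refine (φ.continuous.tendsto _).comp (tendsto_subtype_rng.2 ?_)
    exact (Lp.tendsto_Lp_iff_tendsto_eLpNorm'' _ (fun j => (hadm' j).memLp hk) f₀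
      (ha.memLp hk)).2 hlim
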